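/- Let $d\ge 1$, $0<\alpha\le 1$, $\beta>0$ and $0\le\gamma\le 1$. Let $E_\alpha(z)=\sum_{k\ge 0} z^k/\Gamma(\alpha k+1)$ be the Mittag-Leffler function, let $i^{a}=e^{i\pi a/2}$ for real $a$, and let $\mathcal F[f](\xi)=\int_{\mathbb R^d} f(x)e^{-ix\cdot\xi}\,dx$, extended to tempered distributions by duality. For $t\ge 0$ the function $m_t(\xi)=E_\alpha(i^{-\gamma}t^\alpha|\xi|^\beta)$ is continuous on $\mathbb R^d$; put $K_t=\mathcal F^{-1}[m_t]$. We say that $K_t\in\mathcal S'(\mathbb R^d)$ if there is a tempered distribution whose Fourier transform equals $m_t$ as a distribution, that is, when tested against $C_c^\infty(\mathbb R^d)$. (1) If $\alpha\le\gamma\le 1$, then $K_t\in\mathcal S'(\mathbb R^d)$ for every $t\ge 0$, and as $|\xi|\to\infty$, $$E_\alpha(i^{-\gamma}|\xi|^\beta)=-\frac{i^\gamma}{\Gamma(1-\alpha)}|\xi|^{-\beta}+O(|\xi|^{-2\beta})\quad\text{if }\alpha<\gamma\le 1,$$ $$E_\alpha(i^{-\gamma}|\xi|^\beta)=\frac1\alpha\exp\left(-i|\xi|^{\beta/\alpha}\right)+O(|\xi|^{-\beta})\quad\text{if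 }\alpha=\gamma.$$ (2) If $0\le\gamma<\alpha$, then $K_t\notin\mathcal S'(\mathbb R^d)$ for every $t>0$. -/

import Mathlib

open scoped SchwartzMap FourierTransform

noncomputable section

/-- The two-parameter Mittag-Leffler function
`E_{α,β}(z) = ∑_{k ≥ 0} z ^ k / Γ(α k + β)`, for `α, β > 0` and `z ∈ ℂ`. -/
def mittagLeffler₂ (α β : ℝ) (z : ℂ) : ℂ :=
  ∑' k : ℕ, z ^ k / (Real.Gamma (α * k + β) : ℂ)

/-- The Mittag-Leffler function `E_α = E_{α,1}`. -/
def mittagLeffler (α : ℝ) (z : ℂ) : ℂ := mittagLeffler₂ α 1 z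

/-- The Fourier symbol `ξ ↦ E_α(i^{-γ} t^α |ξ|^β)` on `ℝ^d`. The power `i^{-γ}` is the principal
one, `i^a = exp(i π a / 2)`. -/
def fracSymbol (d : ℕ) (α β γ t : ℝ) (ξ : EuclideanSpace ℝ (Fin d)) : ℂ :=
  mittagLeffler α (Complex.I ^ (-(γ : ℂ)) * ((t ^ α : ℝ) : ℂ) * ((‖ξ‖ ^ β : ℝ) : ℂ))

/-- The dilation `ξ ↦ (2π)⁻¹ ξ` of `ℝ^d`. -/
def dilTwoPi (d : ℕ) : EuclideanSpace ℝ (Fin d) ≃L[ℝ] EuclideanSpace ℝ (Fin d) :=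
  ContinuousLinearEquiv.smulLeft
    (Units.mk0 ((2 * Real.pi)⁻¹ : ℝ) (inv_ne_zero Real.two_pi_pos.ne'))

/-- The Fourier transform `(F φ)(ξ) = ∫ φ(x) e^{-i x·ξ} dx` on the Schwartz space of `ℝ^d`
(see `schwartzFourier_apply`). Mathlib's transform has `e^{-2π i x·ξ}` instead. -/
def schwartzFourier (d : ℕ) :
    𝓢(EuclideanSpace ℝ (Fin d), ℂ) →L[ℂ] 𝓢(EuclideanSpace ℝ (Fin d), ℂ) :=
  (SchwartzMap.compCLMOfContinuousLinearEquiv ℂ (dilTwoPi d)).comp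
    (FourierTransform.fourierCLM ℂ 𝓢(EuclideanSpace ℝ (Fin d), ℂ))

theorem schwartzFourier_apply (d : ℕ) (φ : 𝓢(EuclideanSpace ℝ (Fin d), ℂ))
    (ξ : EuclideanSpace ℝ (Fin d)) :
    schwartzFourier d φ ξ = ∫ x, φ x * Complex.exp (-(Complex.I * (inner ℝ x ξ : ℝ))) := by
  have h : schwartzFourier d φ ξ
      = 𝓕 (φ : EuclideanSpace ℝ (Fin d) → ℂ) ((2 * Real.pi)⁻¹ • ξ) := rfl
  rw [h, Real.fourier_eq']
  refine MeasureTheory.integral_congr_ae (Filter.Eventually.of_forall fun x => ?_)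
  have hpi : (Real.pi : ℂ) ≠ 0 := by exact_mod_cast Real.pi_ne_zero
  simp only [inner_smul_right, smul_eq_mul]
  rw [mul_comm]
  congr 2
  push_cast
  field_simp

/-- The Fourier transform on tempered distributions, `⟨F K, φ⟩ = ⟨K, F φ⟩`. -/
def temperedFourier (d : ℕ) :
    𝓢'(EuclideanSpace ℝ (Fin d), ℂ) →L[ℂ] 𝓢'(EuclideanSpace ℝ (Fin d), ℂ) :=
  PointwiseConvergenceCLM.precomp ℂ (schwartzFourier d)

/-- The tempered distribution `T` is, as a distribution, the (continuous) function `f`: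
`⟨T, φ⟩ = ∫ f φ` for every smooth, compactly supported `φ`. -/
def EqFunction {d : ℕ} (T : 𝓢'(EuclideanSpace ℝ (Fin d), ℂ))
    (f : EuclideanSpace ℝ (Fin d) → ℂ) : Prop :=
  ∀ φ : 𝓢(EuclideanSpace ℝ (Fin d), ℂ), HasCompactSupport (φ : EuclideanSpace ℝ (Fin d) → ℂ) →
    T φ = ∫ ξ, f ξ * φ ξ

/-- `F⁻¹[f] ∈ 𝓢'(ℝ^d)`: some tempered distribution `K` has Fourier transform `f`. The test
functions in `EqFunction` have compact support, so that the right-hand side makes sense for a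
continuous function `f` of arbitrary growth. -/
def InvFourierIsTempered {d : ℕ} (f : EuclideanSpace ℝ (Fin d) → ℂ) : Prop :=
  ∃ K : 𝓢'(EuclideanSpace ℝ (Fin d), ℂ), EqFunction (temperedFourier d K) f

end

open Complex Filter Topology MeasureTheory Set

/-! Along the ray z = i^{-γ} r the function E_α behaves like (1/α) exp(z^{1/α}), with z^{1/α} =
r^{1/α} e^{-iπγ/(2α)}, when γ ≤ α, and like -1/(Γ(1-α) z) when α < γ ≤ 1. In the first case the real
part of the exponent is r^{1/α} cos(πγ/(2α)), which vanishes for γ = α and is positive for γ < α. So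
the symbol is bounded, hence tempered, when γ ≥ α, and grows like exp(κ|ξ|^{β/α}) when γ < α.

The asymptotics come from E_α(z) = (1/2πi) ∫ e^u u^{α-1} / (u^α - z) du over a Hankel contour.
Substituting u = v^p with 1 < p ≤ 2 straightens the contour to a vertical line Re v = c > 0, where
exp(v^p) decays and principal powers are holomorphic. The formula follows from Hankel's integral for
1/Γ (`vertInt_hankelKernel`) by summing a geometric series, for c large. Moving the line to Re v = 1
either meets no pole (`mittagLeffler_eq_vertInt_one`) or crosses the single pole w with w^{pα} = z,
whose residue is the exponential term (`mittagLeffler_cpow_eq`). The integral left over is O(1/|z|)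
along a ray, and expanding it once in 1/z gives the algebraic term.

Exponential size alone does not exclude temperedness: e^x cos(e^x) is the derivative of the bounded
function sin(e^x). `not_invFourierIsTempered_of_exponential` therefore tests against bumps of radius
R^{-M} around a point of norm R, where the symbol is nearly constant. The pairing is then
exponentially large in R, while a tempered distribution allows only polynomial growth. -/

/-! ### Contour shifts between vertical lines -/

/-- The integral of `f` along the vertical line `Re v = c`, with respect to the imaginary part. -/
noncomputable def vertInt (f : ℂ → ℂ) (c : ℝ) : ℂ := ∫ y : ℝ, f (c + y * I)

/-- `f` is `O((1 + (Im v)²)⁻¹)` as `|Im v| → ∞` in the strip `a ≤ Re v ≤ b`. -/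
def StripDecay (f : ℂ → ℂ) (a b : ℝ) : Prop :=
  ∃ C Y : ℝ, ∀ v : ℂ, a ≤ v.re → v.re ≤ b → Y ≤ |v.im| → ‖f v‖ ≤ C * (1 + v.im ^ 2)⁻¹

theorem StripDecay.integrable {f : ℂ → ℂ} {a b c : ℝ} (h : StripDecay f a b) (hac : a ≤ c)
    (hcb : c ≤ b) (hf : Continuous fun y : ℝ => f (c + y * I)) :
    Integrable fun y : ℝ => f (c + y * I) := by
  obtain ⟨C, Y, h⟩ := h
  refine hf.locallyIntegrable.integrable_of_isBigO_cocompact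
    (g := fun y : ℝ => (1 + y ^ 2)⁻¹) ?_ (integrable_inv_one_add_sq.integrableAtFilter _)
  refine Asymptotics.IsBigO.of_bound C ?_
  have h1 : ∀ᶠ y : ℝ in cocompact ℝ, Y ≤ ‖y‖ :=
    (tendsto_norm_cocompact_atTop (E := ℝ)).eventually_ge_atTop Y
  filter_upwards [h1] with y hy
  have := h (c + y * I) (by simpa using hac) (by simpa using hcb) (by simpa using hy)
  have h2 : 0 < 1 + y ^ 2 := by positivity
  simpa [abs_of_pos h2] using this

/-- Cauchy's theorem for a vertical strip. -/
theorem vertInt_eq_of_stripDecay {f : ℂ → ℂ} {a b : ℝ} (hab : a ≤ b)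
    (hc : ContinuousOn f {v | a ≤ v.re ∧ v.re ≤ b})
    (hd : ∀ v : ℂ, a < v.re → v.re < b → DifferentiableAt ℂ f v)
    (h : StripDecay f a b) : vertInt f a = vertInt f b := by
  have hline : ∀ c, a ≤ c → c ≤ b → Continuous fun y : ℝ => f (c + y * I) := by
    intro c h1 h2
    refine hc.comp_continuous (by fun_prop) ?_
    intro y
    simp [h1, h2]
  have ia := h.integrable le_rfl hab (hline a le_rfl hab)
  have ib := h.integrable hab le_rfl (hline b hab le_rfl)
  have ta : Tendsto (fun T : ℝ => ∫ y in (-T)..T, f (a + y * I)) atTop (𝓝 (vertInt f a)) :=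
    intervalIntegral_tendsto_integral ia tendsto_neg_atTop_atBot tendsto_id
  have tb : Tendsto (fun T : ℝ => ∫ y in (-T)..T, f (b + y * I)) atTop (𝓝 (vertInt f b)) :=
    intervalIntegral_tendsto_integral ib tendsto_neg_atTop_atBot tendsto_id
  obtain ⟨C, Y, h⟩ := h
  have hor : ∀ ε : ℝ, |ε| = 1 →
      Tendsto (fun T : ℝ => ∫ x in a..b, f (x + (ε * T : ℝ) * I)) atTop (𝓝 0) := by
    intro ε hε
    have hε2 : ε ^ 2 = 1 := by rw [← sq_abs, hε, one_pow]
    have lim : Tendsto (fun T : ℝ => C * (1 + T ^ 2)⁻¹ * |b - a|) atTop (𝓝 0) := by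
      have : Tendsto (fun T : ℝ => (1 + T ^ 2)⁻¹) atTop (𝓝 0) :=
        (tendsto_atTop_add_const_left _ _ (tendsto_pow_atTop two_ne_zero)).inv_tendsto_atTop
      simpa using (this.const_mul C).mul_const |b - a|
    refine squeeze_zero_norm' ?_ lim
    filter_upwards [eventually_ge_atTop Y, eventually_ge_atTop 0] with T hT hT0
    refine intervalIntegral.norm_integral_le_of_norm_le_const fun x hx => ?_
    rw [uIoc_of_le hab] at hx
    have := h (x + (ε * T : ℝ) * I) (by simpa using hx.1.le) (by simpa using hx.2)
      (by simpa [abs_mul, hε, abs_of_nonneg hT0] using hT)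
    simpa [mul_pow, hε2] using this
  have key : ∀ T : ℝ, 0 ≤ T → (∫ y in (-T)..T, f (b + y * I)) - ∫ y in (-T)..T, f (a + y * I)
      = I * ((∫ x in a..b, f (x + ((-1) * T : ℝ) * I)) - ∫ x in a..b, f (x + (1 * T : ℝ) * I)) := by
    intro T hT
    have := integral_boundary_rect_eq_zero_of_continuousOn_of_differentiableOn f
      (a - T * I) (b + T * I) ?_ ?_
    · simp only [sub_re, add_re, sub_im, add_im, ofReal_re, ofReal_im, mul_re, mul_im, I_re, I_im,
        smul_eq_mul, mul_zero, mul_one, sub_zero, zero_sub, zero_add, add_zero] at this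
      simp only [neg_one_mul, one_mul]
      linear_combination (-I) * this + ((∫ y in (-T)..T, f (b + y * I))
        - ∫ y in (-T)..T, f (a + y * I)) * I_mul_I
    · refine hc.mono fun v hv => ?_
      rw [mem_reProdIm] at hv
      have := hv.1
      simp [uIcc_of_le hab] at this
      exact this
    · intro v hv
      rw [mem_reProdIm] at hv
      have := hv.1
      simp [hab] at this
      exact (hd v this.1 this.2).differentiableWithinAt
  have l1 := tb.sub ta
  have l2 := ((hor (-1) (by simp)).sub (hor 1 (by simp))).const_mul I
  have l3 : Tendsto (fun T : ℝ => (∫ y in (-T)..T, f (b + y * I)) - ∫ y in (-T)..T, f (a + y * I))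
      atTop (𝓝 (I * (0 - 0))) := by
    refine l2.congr' ?_
    filter_upwards [eventually_ge_atTop 0] with T hT using (key T hT).symm
  have := tendsto_nhds_unique l1 l3
  simp only [sub_self, mul_zero] at this
  exact (sub_eq_zero.1 this).symm

/-- High up in the strip, arg v is close to ±π/2, so p·arg v lies beyond ±π/2 (this is where p > 1
enters) but within ±π. Hence Re v^p ≤ -δ|v|, and the exponential beats every power. -/
theorem norm_exp_cpow_mul_le {p : ℝ} (hp : 1 < p) (hp2 : p ≤ 2) (b m : ℝ) :
    ∃ Y : ℝ, ∀ v : ℂ, 0 ≤ v.re → v.re ≤ b → Y ≤ |v.im| →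
      ‖exp (v ^ (p : ℂ))‖ * ‖v‖ ^ m ≤ (1 + v.im ^ 2)⁻¹ := by
  have hπ := Real.pi_pos
  have hp0 : 0 < p := by linarith
  -- Midpoint of π/(2p) and π/2, so that cos θ > 0 while cos(pθ) < 0.
  set θ : ℝ := (Real.pi / (2 * p) + Real.pi / 2) / 2 with hθ
  have h1 : Real.pi / (2 * p) < Real.pi / 2 := by
    apply div_lt_div_of_pos_left hπ <;> linarith
  have h1' : 0 < Real.pi / (2 * p) := by positivity
  have hpθ : p * θ = Real.pi / 4 + p * Real.pi / 4 := by
    rw [hθ]; field_simp; ring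
  have hcθ : 0 < Real.cos θ := Real.cos_pos_of_mem_Ioo ⟨by linarith, by linarith⟩
  set δ : ℝ := -Real.cos (p * θ) with hδ
  have hδ0 : 0 < δ := by
    rw [hδ, neg_pos]
    apply Real.cos_neg_of_pi_div_two_lt_of_lt <;> rw [hpθ] <;> nlinarith
  have hlim : ∀ᶠ x : ℝ in atTop, x ^ (m + 2) * Real.exp (-δ * x) < 1 / 2 :=
    (tendsto_rpow_mul_exp_neg_mul_atTop_nhds_zero (m + 2) δ hδ0).eventually_lt_const (by norm_num)
  obtain ⟨X, hX⟩ := eventually_atTop.1 hlim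
  -- Since cos(arg v) = Re v / |v| ≤ b / |v|, the bound |v| ≥ b / cos θ forces |arg v| ≥ θ.
  refine ⟨max X (max 1 (b / Real.cos θ)), fun v hv0 hvb hvY => ?_⟩
  have hvn : |v.im| ≤ ‖v‖ := abs_im_le_norm v
  have hvX : X ≤ ‖v‖ := (le_max_left _ _).trans (hvY.trans hvn)
  have hv1 : 1 ≤ ‖v‖ := ((le_max_left _ _).trans (le_max_right _ _)).trans (hvY.trans hvn)
  have hvb' : b / Real.cos θ ≤ ‖v‖ :=
    ((le_max_right _ _).trans (le_max_right _ _)).trans (hvY.trans hvn)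
  have hvpos : 0 < ‖v‖ := by linarith
  have hcos : Real.cos |v.arg| ≤ Real.cos θ := by
    rw [Real.cos_abs, Complex.cos_arg (norm_pos_iff.1 hvpos), div_le_iff₀ hvpos]
    rw [div_le_iff₀ hcθ] at hvb'
    linarith
  have harg : |v.arg| ≤ Real.pi / 2 := Complex.abs_arg_le_pi_div_two_iff.2 hv0
  have hargθ : θ ≤ |v.arg| := by
    by_contra! hlt
    exact absurd (Real.cos_lt_cos_of_nonneg_of_le_pi (abs_nonneg _) (by linarith) hlt)
      (not_lt.2 hcos)
  have hcosp : Real.cos (v.arg * p) ≤ -δ := by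
    rw [hδ, neg_neg, ← Real.cos_abs, abs_mul, abs_of_pos hp0, mul_comm]
    apply Real.cos_le_cos_of_nonneg_of_le_pi
    · rw [hpθ]; positivity
    · nlinarith
    · exact mul_le_mul_of_nonneg_left hargθ hp0.le
  have hre : (v ^ (p : ℂ)).re ≤ -δ * ‖v‖ := by
    rw [Complex.cpow_ofReal_re]
    have h3 : ‖v‖ ≤ ‖v‖ ^ p := by
      simpa using Real.rpow_le_rpow_of_exponent_le hv1 hp.le
    nlinarith [Real.rpow_nonneg hvpos.le p]
  rw [Complex.norm_exp]
  have h4 := hX _ hvX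
  rw [Real.rpow_add hvpos, Real.rpow_two] at h4
  have h5 : Real.exp (v ^ (p : ℂ)).re ≤ Real.exp (-δ * ‖v‖) := Real.exp_le_exp.2 hre
  rw [← one_div, le_div_iff₀ (by positivity)]
  have h6 : v.im ^ 2 ≤ ‖v‖ ^ 2 := by
    rw [← sq_abs]; gcongr
  have h7 : 0 ≤ ‖v‖ ^ m := Real.rpow_nonneg hvpos.le m
  calc Real.exp (v ^ (p : ℂ)).re * ‖v‖ ^ m * (1 + v.im ^ 2)
      ≤ Real.exp (-δ * ‖v‖) * ‖v‖ ^ m * (2 * ‖v‖ ^ 2) := by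
        gcongr
        nlinarith
    _ ≤ 1 := by linarith

theorem stripDecay_of_norm_le {p : ℝ} (hp : 1 < p) (hp2 : p ≤ 2) {f : ℂ → ℂ} {a b : ℝ}
    (ha : 0 ≤ a) (A m Y : ℝ) (h : ∀ v : ℂ, a ≤ v.re → v.re ≤ b → Y ≤ |v.im| →
      ‖f v‖ ≤ A * (‖exp (v ^ (p : ℂ))‖ * ‖v‖ ^ m)) : StripDecay f a b := by
  obtain ⟨Z, hZ⟩ := norm_exp_cpow_mul_le hp hp2 b m
  refine ⟨|A|, max Y Z, fun v h1 h2 h3 => ?_⟩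
  refine (h v h1 h2 ((le_max_left _ _).trans h3)).trans ?_
  have h4 := hZ v (ha.trans h1) h2 ((le_max_right _ _).trans h3)
  refine (mul_le_mul_of_nonneg_right (le_abs_self A) (by positivity)).trans ?_
  gcongr

/-! ### Hankel's formula for 1/Γ -/

/-- The Hankel kernel for `1 / Γ(s)` in the variable `v`, where `u = v ^ p`. -/
noncomputable def hankelKernel (p s : ℝ) (v : ℂ) : ℂ :=
  p * exp (v ^ (p : ℂ)) * v ^ ((p * (1 - s) - 1 : ℝ) : ℂ)

theorem norm_hankelKernel {p : ℝ} (hp : 0 ≤ p) (s : ℝ) (v : ℂ) :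
    ‖hankelKernel p s v‖ = p * (‖exp (v ^ (p : ℂ))‖ * ‖v‖ ^ (p * (1 - s) - 1)) := by
  rw [hankelKernel, norm_mul, norm_mul, Complex.norm_real, Real.norm_of_nonneg hp, mul_assoc,
    Complex.norm_cpow_real]

theorem mem_slitPlane_of_re_pos {v : ℂ} (hv : 0 < v.re) : v ∈ slitPlane := Or.inl hv

theorem differentiableAt_hankelKernel (p s : ℝ) {v : ℂ} (hv : 0 < v.re) :
    DifferentiableAt ℂ (hankelKernel p s) v := by
  have := mem_slitPlane_of_re_pos hv
  unfold hankelKernel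
  fun_prop (disch := assumption)

theorem stripDecay_hankelKernel {p : ℝ} (hp : 1 < p) (hp2 : p ≤ 2) (s : ℝ) {a : ℝ} (ha : 0 ≤ a)
    (b : ℝ) : StripDecay (hankelKernel p s) a b := by
  refine stripDecay_of_norm_le hp hp2 ha p (p * (1 - s) - 1) 0 fun v _ _ _ => ?_
  rw [norm_hankelKernel (by linarith)]

theorem ofReal_mul_cpow {x : ℝ} (hx : 0 < x) {z : ℂ} (hz : z ≠ 0) (a : ℂ) :
    ((x : ℂ) * z) ^ a = (x : ℂ) ^ a * z ^ a := by
  have hx' : (x : ℂ) ≠ 0 := ofReal_ne_zero.2 hx.ne'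
  rw [cpow_def_of_ne_zero (mul_ne_zero hx' hz), cpow_def_of_ne_zero hx', cpow_def_of_ne_zero hz,
    Complex.log_ofReal_mul hx hz, ← Complex.exp_add, ofReal_log hx.le]
  ring_nf

theorem I_cpow (a : ℂ) : I ^ a = exp (Real.pi / 2 * I * a) := by
  rw [cpow_def_of_ne_zero I_ne_zero, log_I]

/-- Euler's integral for the Gamma function along a complex ray. -/
theorem integral_cpow_mul_exp_neg_complex_mul_Ioi {a : ℝ} (ha : 0 < a) {r : ℂ} (hr : 0 < r.re) :
    ∫ t in Ioi (0 : ℝ), (t : ℂ) ^ ((a : ℂ) - 1) * exp (-(r * t)) = (1 / r) ^ (a : ℂ) * Gamma a := by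
  set U : Set ℂ := {z | 0 < z.re} with hU
  have hUo : IsOpen U := isOpen_lt continuous_const continuous_re
  have hcont : ∀ r : ℂ, ∀ b : ℂ, ContinuousOn (fun t : ℝ => (t : ℂ) ^ b * exp (-(r * t)))
      (Ioi 0) := by
    intro r b t ht
    have : (t : ℂ) ∈ slitPlane := ofReal_mem_slitPlane.2 ht
    refine ContinuousAt.continuousWithinAt ?_
    have h1 : ContinuousAt (fun t : ℝ => (t : ℂ) ^ b) t :=
      ContinuousAt.cpow (by fun_prop) continuousAt_const this
    exact h1.mul (by fun_prop)
  have hnorm : ∀ (b : ℝ) (r : ℂ) (t : ℝ), 0 < t →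
      ‖(t : ℂ) ^ (b : ℂ) * exp (-(r * t))‖ = t ^ b * Real.exp (-r.re * t) := by
    intro b r t ht
    rw [norm_mul, norm_cpow_real, norm_real, Real.norm_of_nonneg ht.le, Complex.norm_exp]
    simp
  have hint : ∀ b : ℝ, -1 < b → ∀ δ : ℝ, 0 < δ →
      IntegrableOn (fun t : ℝ => t ^ b * Real.exp (-δ * t)) (Ioi 0) := by
    intro b hb δ hδ
    simpa using integrableOn_rpow_mul_exp_neg_mul_rpow hb zero_lt_one hδ
  have hF : DifferentiableOn ℂ
      (fun r => ∫ t in Ioi (0 : ℝ), (t : ℂ) ^ ((a : ℂ) - 1) * exp (-(r * t))) U := by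
    intro r (hr : 0 < r.re)
    have hs : {z : ℂ | r.re / 2 < z.re} ∈ 𝓝 r :=
      (isOpen_lt continuous_const continuous_re).mem_nhds (by simp; linarith)
    refine ((hasDerivAt_integral_of_dominated_loc_of_deriv_le hs (μ := volume.restrict (Ioi 0))
      (F := fun r (t : ℝ) => (t : ℂ) ^ ((a : ℂ) - 1) * exp (-(r * t)))
      (F' := fun r (t : ℝ) => -((t : ℂ) ^ (a : ℂ) * exp (-(r * t))))
      (bound := fun t => t ^ a * Real.exp (-(r.re / 2) * t)) ?_ ?_ ?_ ?_ ?_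
      ?_).2.differentiableAt).differentiableWithinAt
    · exact Eventually.of_forall fun z => (hcont z _).aestronglyMeasurable measurableSet_Ioi
    · refine ((hint (a - 1) (by linarith) r.re hr).mono'
        ((hcont r _).aestronglyMeasurable measurableSet_Ioi) ?_)
      filter_upwards [ae_restrict_mem measurableSet_Ioi] with t ht
      have := hnorm (a - 1) r t ht
      push_cast at this
      exact this.le
    · exact ((hcont r _).aestronglyMeasurable measurableSet_Ioi).neg
    · filter_upwards [ae_restrict_mem measurableSet_Ioi] with t ht z hz
      have ht' : (0 : ℝ) < t := ht
      have hz' : r.re / 2 < z.re := hz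
      rw [norm_neg, hnorm a z t ht]
      gcongr
    · exact hint a (by linarith) _ (by linarith)
    · filter_upwards [ae_restrict_mem measurableSet_Ioi] with t ht z _
      have ht' : (t : ℂ) ≠ 0 := ofReal_ne_zero.2 (ne_of_gt ht)
      have h1 : HasDerivAt (fun z : ℂ => exp (-(z * t))) (exp (-(z * t)) * -(1 * t)) z :=
        ((hasDerivAt_id z).mul_const (t : ℂ)).neg.cexp
      refine (h1.const_mul ((t : ℂ) ^ ((a : ℂ) - 1))).congr_deriv ?_
      rw [cpow_sub _ _ ht', cpow_one]
      field_simp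
  have hG : DifferentiableOn ℂ (fun r : ℂ => (1 / r) ^ (a : ℂ) * Gamma a) U := by
    intro r (hr : 0 < r.re)
    have h0 := ne_zero_of_re_pos hr
    have h1 : 1 / r ∈ slitPlane := by
      refine Or.inl ?_
      rw [one_div, inv_re]
      exact div_pos hr (normSq_pos.2 h0)
    refine DifferentiableAt.differentiableWithinAt ?_
    refine DifferentiableAt.mul_const (DifferentiableAt.cpow_const ?_ h1) _
    exact (differentiableAt_const _).div differentiableAt_id h0
  -- Both sides are holomorphic in r on the right half-plane, so agreement at positive reals
  -- accumulating at 1 suffices.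
  have hfreq : ∃ᶠ z in 𝓝[≠] (1 : ℂ),
      ∫ t in Ioi (0 : ℝ), (t : ℂ) ^ ((a : ℂ) - 1) * exp (-(z * t)) = (1 / z) ^ (a : ℂ) * Gamma a := by
    have ht : Tendsto (fun x : ℝ => (x : ℂ)) (𝓝[≠] 1) (𝓝[≠] (1 : ℂ)) := by
      refine tendsto_nhdsWithin_of_tendsto_nhds_of_eventually_within _ ?_ ?_
      · exact (continuous_ofReal.tendsto' 1 1 (by simp)).mono_left nhdsWithin_le_nhds
      · filter_upwards [self_mem_nhdsWithin] with x hx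
        simpa using hx
    refine ht.frequently (Eventually.frequently ?_)
    filter_upwards [mem_nhdsWithin_of_mem_nhds (Ioi_mem_nhds (show (0 : ℝ) < 1 by norm_num))]
      with x hx
    exact Complex.integral_cpow_mul_exp_neg_mul_Ioi (by simpa using ha) hx
  exact (hF.analyticOnNhd hUo).eqOn_of_preconnected_of_frequently_eq (hG.analyticOnNhd hUo)
    (convex_halfSpace_re_gt 0).isPreconnected (z₀ := 1) (by simp [hU]) hfreq hr

theorem hankelKernel_mul_I (p s : ℝ) {y : ℝ} (hy : 0 < y) :
    hankelKernel p s (y * I) = I ^ ((p * (1 - s) - 1 : ℝ) : ℂ) *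
      ((p * y ^ (p - 1) : ℝ) • (((y ^ p : ℝ) : ℂ) ^ (((1 - s : ℝ) : ℂ) - 1) *
        exp (-(-(I ^ (p : ℂ)) * ((y ^ p : ℝ) : ℂ))))) := by
  have h1 : ((y ^ p : ℝ) : ℂ) ^ (((1 - s : ℝ) : ℂ) - 1) = ((y ^ (p * -s) : ℝ) : ℂ) := by
    rw [show (((1 - s : ℝ) : ℂ) - 1) = ((-s : ℝ) : ℂ) by push_cast; ring,
      ← ofReal_cpow (Real.rpow_nonneg hy.le p), ← Real.rpow_mul hy.le]
  have h2 : y ^ (p * (1 - s) - 1) = y ^ (p - 1) * y ^ (p * -s) := by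
    rw [← Real.rpow_add hy]; ring_nf
  rw [hankelKernel, ofReal_mul_cpow hy I_ne_zero, ofReal_mul_cpow hy I_ne_zero,
    ← ofReal_cpow hy.le, ← ofReal_cpow hy.le, h1, h2, real_smul]
  push_cast
  ring_nf

/-- The substitution x = y^p turns the integral over the upper imaginary axis into Euler's integral
with complex rate -i^p. Its argument π(p/2 - 1) lies in (-π/2, 0] because 1 < p ≤ 2, so the rate has
positive real part. -/
theorem integral_hankelKernel_mul_I {p s : ℝ} (hp : 1 < p) (hp2 : p ≤ 2) (hs : s < 1) :
    ∫ y in Ioi (0 : ℝ), hankelKernel p s (y * I)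
      = Real.Gamma (1 - s) * exp (Real.pi * (1 / 2 - s) * I) := by
  have hπ := Real.pi_pos
  have hB : -(I ^ (p : ℂ)) = exp ((Real.pi * (p / 2 - 1) : ℝ) * I) := by
    rw [I_cpow, show ((Real.pi * (p / 2 - 1) : ℝ) * I : ℂ) = Real.pi / 2 * I * p - Real.pi * I by
      push_cast; ring, Complex.exp_sub, exp_pi_mul_I]
    ring
  have hBre : 0 < (-(I ^ (p : ℂ))).re := by
    rw [hB, exp_ofReal_mul_I_re]
    apply Real.cos_pos_of_mem_Ioo
    constructor <;> nlinarith
  have hBinv : 1 / -(I ^ (p : ℂ)) = exp ((Real.pi * (1 - p / 2) : ℝ) * I) := by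
    rw [hB, one_div, ← Complex.exp_neg]
    congr 1
    push_cast
    ring
  have hlog : log (1 / -(I ^ (p : ℂ))) = (Real.pi * (1 - p / 2) : ℝ) * I := by
    rw [hBinv, Complex.log_exp] <;> simp <;> nlinarith
  have hG := integral_cpow_mul_exp_neg_complex_mul_Ioi (a := 1 - s) (by linarith) hBre
  have hcv := integral_comp_rpow_Ioi_of_pos (p := p) (by linarith)
    (g := fun x : ℝ => (x : ℂ) ^ (((1 - s : ℝ) : ℂ) - 1) * exp (-(-(I ^ (p : ℂ)) * (x : ℂ))))
  rw [setIntegral_congr_fun measurableSet_Ioi fun y hy => hankelKernel_mul_I p s hy,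
    integral_const_mul, hcv]
  simp only [neg_mul] at hG ⊢
  have hne : 1 / -(I ^ (p : ℂ)) ≠ 0 := by rw [hBinv]; exact exp_ne_zero _
  rw [hG, cpow_def_of_ne_zero hne, hlog, I_cpow, ← mul_assoc,
    ← Complex.exp_add, Complex.Gamma_ofReal, mul_comm]
  congr 2
  push_cast
  ring

theorem hankelKernel_conj (p s : ℝ) {v : ℂ} (hv : v.arg ≠ Real.pi) :
    hankelKernel p s ((starRingEnd ℂ) v) = (starRingEnd ℂ) (hankelKernel p s v) := by
  unfold hankelKernel
  rw [conj_cpow _ _ hv, conj_cpow _ _ hv, map_mul, map_mul, ← exp_conj, conj_ofReal, conj_ofReal]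

theorem continuousAt_hankelKernel {p s : ℝ} (hp : 1 < p) (hs : s ≤ 0) {v : ℂ} (hv : 0 ≤ v.re) :
    ContinuousAt (hankelKernel p s) v := by
  have h1 : ContinuousAt (fun v : ℂ => v ^ (p : ℂ)) v :=
    continuousAt_cpow_const_of_re_pos (Or.inl hv) (by simpa using by linarith)
  have h2 := continuousAt_cpow_const_of_re_pos (z := v) (w := ((p * (1 - s) - 1 : ℝ) : ℂ))
    (Or.inl hv) (by rw [ofReal_re]; nlinarith)
  exact (continuousAt_const.mul h1.cexp).mul h2

theorem continuous_line_of_continuousAt {f : ℂ → ℂ} {c : ℝ}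
    (hf : ∀ v : ℂ, v.re = c → ContinuousAt f v) : Continuous fun y : ℝ => f (c + y * I) := by
  rw [continuous_iff_continuousAt]
  intro y
  exact ContinuousAt.comp (f := fun y : ℝ => (c + y * I : ℂ)) (hf _ (by simp))
    (by fun_prop)

theorem continuous_hankelKernel_line (p s : ℝ) {c : ℝ} (hc : 0 < c) :
    Continuous fun y : ℝ => hankelKernel p s (c + y * I) :=
  continuous_line_of_continuousAt fun _ hv =>
    (differentiableAt_hankelKernel p s (hv ▸ hc)).continuousAt

theorem integrable_hankelKernel_line {p : ℝ} (hp : 1 < p) (hp2 : p ≤ 2) (s : ℝ) {c : ℝ}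
    (hc : 0 < c) : Integrable fun y : ℝ => hankelKernel p s (c + y * I) :=
  (stripDecay_hankelKernel hp hp2 s hc.le c).integrable le_rfl le_rfl
    (continuous_hankelKernel_line p s hc)

/-- The two halves of the imaginary axis contribute complex conjugates, whose sum is 2Γ(1-s)
sin(πs). The reflection formula converts this to 2π/Γ(s). -/
theorem vertInt_hankelKernel_zero {p s : ℝ} (hp : 1 < p) (hp2 : p ≤ 2) (hs : s ≤ 0) :
    vertInt (hankelKernel p s) 0 = 2 * Real.pi * ((Real.Gamma s)⁻¹ : ℝ) := by
  have hi : Integrable fun y : ℝ => hankelKernel p s ((0 : ℝ) + y * I) :=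
    (stripDecay_hankelKernel hp hp2 s le_rfl 0).integrable le_rfl le_rfl
      (continuous_line_of_continuousAt fun _ hv => continuousAt_hankelKernel hp hs hv.ge)
  rw [vertInt, ← intervalIntegral.integral_Iic_add_Ioi (b := 0) hi.integrableOn hi.integrableOn,
    ← neg_zero, ← integral_comp_neg_Ioi, neg_zero]
  have h1 : ∫ y in Ioi (0 : ℝ), hankelKernel p s ((0 : ℝ) + (-y : ℝ) * I)
      = (starRingEnd ℂ) (∫ y in Ioi (0 : ℝ), hankelKernel p s (y * I)) := by
    rw [← integral_conj]
    refine setIntegral_congr_fun measurableSet_Ioi fun y hy => ?_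
    have hy' : (0 : ℝ) < y := hy
    rw [← hankelKernel_conj]
    · simp
    · rw [arg_real_mul _ hy', arg_I]
      linarith [Real.pi_pos]
  have h2 : ∫ y in Ioi (0 : ℝ), hankelKernel p s ((0 : ℝ) + y * I)
      = ∫ y in Ioi (0 : ℝ), hankelKernel p s (y * I) := by simp
  rw [h1, h2, integral_hankelKernel_mul_I hp hp2 (by linarith)]
  have h3 : (Real.pi * (1 / 2 - s) * I : ℂ) = ((Real.pi * (1 / 2 - s) : ℝ) : ℂ) * I := by
    push_cast; ring
  have h4 : (starRingEnd ℂ) (Real.Gamma (1 - s) * exp ((Real.pi * (1 / 2 - s) : ℝ) * I))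
      + Real.Gamma (1 - s) * exp ((Real.pi * (1 / 2 - s) : ℝ) * I)
      = ((2 * (Real.Gamma (1 - s) * Real.sin (Real.pi * s)) : ℝ) : ℂ) := by
    rw [add_comm, Complex.add_conj, re_ofReal_mul, exp_ofReal_mul_I_re,
      show Real.pi * (1 / 2 - s) = Real.pi / 2 - Real.pi * s by ring, Real.cos_pi_div_two_sub]
  rw [h3, h4]
  have hG : 0 < Real.Gamma (1 - s) := Real.Gamma_pos_of_pos (by linarith)
  have h5 := Real.Gamma_mul_Gamma_one_sub s
  rw [← ofReal_ofNat, ← ofReal_mul, ← ofReal_mul, mul_assoc]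
  congr 2
  -- This also holds at the poles s = 0, -1, …: there sin(πs) = 0, and the conventions Γ(s) = 0 and
  -- x / 0 = 0 agree.
  have h6 : Real.Gamma s = Real.pi / (Real.Gamma (1 - s) * Real.sin (Real.pi * s)) := by
    rw [mul_comm, ← div_div, ← h5, mul_div_cancel_right₀ _ hG.ne']
  rw [h6, inv_div, mul_div_cancel₀ _ Real.pi_ne_zero]

theorem vertInt_hankelKernel_of_nonpos {p s : ℝ} (hp : 1 < p) (hp2 : p ≤ 2) (hs : s ≤ 0) {c : ℝ}
    (hc : 0 < c) : vertInt (hankelKernel p s) c = 2 * Real.pi * ((Real.Gamma s)⁻¹ : ℝ) := by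
  rw [← vertInt_hankelKernel_zero hp hp2 hs]
  exact (vertInt_eq_of_stripDecay hc.le
    (fun v hv => (continuousAt_hankelKernel hp hs hv.1).continuousWithinAt)
    (fun v hv _ => differentiableAt_hankelKernel p s hv)
    (stripDecay_hankelKernel hp hp2 s le_rfl c)).symm

/-- Integration by parts: F(v) = exp(v^p) v^{-ps} has derivative equal to the kernel at s minus s
times the kernel at s + 1, and F is integrable along the line. This mirrors Γ(s+1) = sΓ(s). -/
theorem vertInt_hankelKernel_add_one {p : ℝ} (hp : 1 < p) (hp2 : p ≤ 2) (s : ℝ) {c : ℝ}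
    (hc : 0 < c) :
    vertInt (hankelKernel p s) c = s * vertInt (hankelKernel p (s + 1)) c := by
  set F : ℂ → ℂ := fun v => exp (v ^ (p : ℂ)) * v ^ ((-(p * s) : ℝ) : ℂ) with hF
  have hFd : ∀ v : ℂ, 0 < v.re →
      HasDerivAt F (hankelKernel p s v - s * hankelKernel p (s + 1) v) v := by
    intro v hv
    have hv0 := ne_zero_of_re_pos hv
    have hm := mem_slitPlane_of_re_pos hv
    have d1 := (hasDerivAt_id v).cpow_const (c := (p : ℂ)) hm
    have d2 := (hasDerivAt_id v).cpow_const (c := ((-(p * s) : ℝ) : ℂ)) hm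
    refine (d1.cexp.mul d2).congr_deriv ?_
    have e1 : v ^ ((p * (1 - s) - 1 : ℝ) : ℂ) = v ^ ((p : ℂ) - 1) * v ^ ((-(p * s) : ℝ) : ℂ) := by
      rw [← cpow_add _ _ hv0]; congr 1; push_cast; ring
    have e2 : v ^ ((p * (1 - (s + 1)) - 1 : ℝ) : ℂ) = v ^ (((-(p * s) : ℝ) : ℂ) - 1) := by
      congr 1; push_cast; ring
    simp only [hankelKernel, e1, e2, id]
    push_cast
    ring
  have hFi : Integrable fun y : ℝ => F (c + y * I) := by
    refine StripDecay.integrable (a := c) (b := c) ?_ le_rfl le_rfl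
      (continuous_line_of_continuousAt fun v hv => (hFd v (hv ▸ hc)).continuousAt)
    refine stripDecay_of_norm_le hp hp2 hc.le 1 (-(p * s)) 0 fun v _ _ _ => ?_
    rw [hF, norm_mul, norm_cpow_real, one_mul]
  have i1 := integrable_hankelKernel_line hp hp2 s hc
  have i2 := integrable_hankelKernel_line hp hp2 (s + 1) hc
  have := integral_eq_zero_of_hasDerivAt_of_integrable (f := fun y : ℝ => F (c + y * I))
    (f' := fun y : ℝ => (hankelKernel p s (c + y * I) - s * hankelKernel p (s + 1) (c + y * I)) * I)
    (fun y => by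
      have hl : HasDerivAt (fun y : ℝ => (c + y * I : ℂ)) I y := by
        simpa using ((hasDerivAt_id y).ofReal_comp.mul_const I).const_add (c : ℂ)
      exact (hFd _ (by simpa using hc)).comp y hl)
    ((i1.sub (i2.const_mul _)).mul_const _) hFi
  rw [integral_mul_const, integral_sub i1 (i2.const_mul _), integral_const_mul] at this
  exact sub_eq_zero.1 ((mul_eq_zero.1 this).resolve_right I_ne_zero)

theorem continuousAt_vertInt_hankelKernel {p : ℝ} (hp : 1 < p) (hp2 : p ≤ 2) (s₀ : ℝ) {c : ℝ}
    (hc : 0 < c) : ContinuousAt (fun s => vertInt (hankelKernel p s) c) s₀ := by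
  have hline : ∀ y : ℝ, (c + y * I : ℂ) ≠ 0 := fun y => ne_zero_of_re_pos (by simpa using hc)
  -- For s within 1 of s₀, the power of |v| is largest at s₀ - 1 if |v| ≥ 1 and at s₀ + 1 if |v| ≤
  -- 1; the sum dominates both cases.
  refine continuousAt_of_dominated (bound := fun y : ℝ =>
    ‖hankelKernel p (s₀ + 1) (c + y * I)‖ + ‖hankelKernel p (s₀ - 1) (c + y * I)‖)
    (Eventually.of_forall fun s => (continuous_hankelKernel_line p s hc).aestronglyMeasurable) ?_
    ((integrable_hankelKernel_line hp hp2 _ hc).norm.add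
      (integrable_hankelKernel_line hp hp2 _ hc).norm)
    (Eventually.of_forall fun y => ?_)
  · filter_upwards [Icc_mem_nhds (show s₀ - 1 < s₀ by linarith) (show s₀ < s₀ + 1 by linarith)]
      with s hs
    refine Eventually.of_forall fun y => ?_
    have hp0 : 0 < p := by linarith
    have hn : 0 < ‖(c + y * I : ℂ)‖ := norm_pos_iff.2 (hline y)
    rw [norm_hankelKernel hp0.le, norm_hankelKernel hp0.le, norm_hankelKernel hp0.le, ← mul_add,
      ← mul_add]
    gcongr
    rcases le_total 1 ‖(c + y * I : ℂ)‖ with h | h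
    · refine le_add_of_nonneg_of_le (by positivity) ?_
      apply Real.rpow_le_rpow_of_exponent_le h
      nlinarith [hs.1]
    · refine le_add_of_le_of_nonneg ?_ (by positivity)
      apply Real.rpow_le_rpow_of_exponent_ge hn h
      nlinarith [hs.2]
  · have hne := hline y
    unfold hankelKernel
    refine continuousAt_const.mul (ContinuousAt.const_cpow ?_ (Or.inl hne))
    fun_prop

/-- Hankel's formula for the reciprocal of the Gamma function. -/
theorem vertInt_hankelKernel {p : ℝ} (hp : 1 < p) (hp2 : p ≤ 2) (s : ℝ) {c : ℝ} (hc : 0 < c) :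
    vertInt (hankelKernel p s) c = 2 * Real.pi * ((Real.Gamma s)⁻¹ : ℝ) := by
  have step : ∀ s : ℝ, s ≠ 0 →
      vertInt (hankelKernel p s) c = 2 * Real.pi * ((Real.Gamma s)⁻¹ : ℝ) →
      vertInt (hankelKernel p (s + 1)) c = 2 * Real.pi * ((Real.Gamma (s + 1))⁻¹ : ℝ) := by
    intro s hs h
    have hs' : (s : ℂ) ≠ 0 := ofReal_ne_zero.2 hs
    rw [vertInt_hankelKernel_add_one hp hp2 s hc] at h
    apply mul_left_cancel₀ hs'
    rw [h, Real.Gamma_add_one hs]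
    push_cast
    field_simp
  have h1 : ∀ s : ℝ, s < 1 →
      vertInt (hankelKernel p s) c = 2 * Real.pi * ((Real.Gamma s)⁻¹ : ℝ) := by
    intro s hs
    rcases eq_or_ne s 0 with rfl | h0
    · exact vertInt_hankelKernel_of_nonpos hp hp2 le_rfl hc
    simpa using step (s - 1) (by linarith) (vertInt_hankelKernel_of_nonpos hp hp2 (by linarith) hc)
  -- The recurrence cannot be divided by s at s = 0, so s = 1 is reached as a limit from the left.
  have h2 : vertInt (hankelKernel p 1) c = 2 * Real.pi * ((Real.Gamma 1)⁻¹ : ℝ) := by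
    have t1 := (continuousAt_vertInt_hankelKernel hp hp2 1 hc).tendsto.mono_left
      (nhdsWithin_le_nhds (s := Iio 1))
    have hg : ContinuousAt (fun s : ℝ => (2 * Real.pi * ((Real.Gamma s)⁻¹ : ℝ) : ℂ)) 1 := by
      have : ContinuousAt Real.Gamma 1 :=
        (Real.differentiableAt_Gamma fun m => by linarith [m.cast_nonneg (α := ℝ)]).continuousAt
      have := this.inv₀ (by simp)
      exact continuousAt_const.mul (continuous_ofReal.continuousAt.comp this)
    have t2 := hg.tendsto.mono_left (nhdsWithin_le_nhds (s := Iio 1))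
    refine tendsto_nhds_unique t1 (t2.congr' ?_)
    filter_upwards [self_mem_nhdsWithin] with s hs using (h1 s hs).symm
  have h3 : ∀ n : ℕ, ∀ s : ℝ, s ≤ n + 1 →
      vertInt (hankelKernel p s) c = 2 * Real.pi * ((Real.Gamma s)⁻¹ : ℝ) := by
    intro n
    induction n with
    | zero =>
      intro s hs
      rcases (show s ≤ 1 by simpa using hs).lt_or_eq with h | rfl
      · exact h1 s h
      · exact h2
    | succ n ih =>
      intro s hs
      rcases lt_or_ge s 1 with h | h
      · exact h1 s h
      rcases h.lt_or_eq with h | rfl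
      · have := step (s - 1) (by linarith) (ih (s - 1) (by push_cast at hs; linarith))
        simpa using this
      · exact h2
  obtain ⟨n, hn⟩ := exists_nat_ge s
  exact h3 n s (by linarith)

/-! ### Convergence and continuity of E_α -/

/-- Raising s from 1 multiplies the kernel by v^{-p(s-1)}. The resulting geometric decay in s is
what makes the sums over s = αk + 1 converge. -/
theorem norm_hankelKernel_le {p s c : ℝ} (hp : 0 ≤ p) (hs : 1 ≤ s) (hc : 0 < c) {v : ℂ}
    (hv : c ≤ ‖v‖) : ‖hankelKernel p s v‖ ≤ c ^ (-(p * (s - 1))) * ‖hankelKernel p 1 v‖ := by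
  have hv0 : 0 < ‖v‖ := hc.trans_le hv
  rw [norm_hankelKernel hp, norm_hankelKernel hp,
    show p * (1 - s) - 1 = p * (1 - 1) - 1 + -(p * (s - 1)) by ring, Real.rpow_add hv0]
  have h1 : ‖v‖ ^ (-(p * (s - 1))) ≤ c ^ (-(p * (s - 1))) :=
    Real.rpow_le_rpow_of_nonpos hc hv (by nlinarith)
  calc _ = p * (‖exp (v ^ (p : ℂ))‖ * ‖v‖ ^ (p * (1 - 1) - 1)) * ‖v‖ ^ (-(p * (s - 1))) := by ring
    _ ≤ p * (‖exp (v ^ (p : ℂ))‖ * ‖v‖ ^ (p * (1 - 1) - 1)) * c ^ (-(p * (s - 1))) := by gcongr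
    _ = _ := by ring

theorem le_norm_line {c : ℝ} (hc : 0 ≤ c) (y : ℝ) : c ≤ ‖(c + y * I : ℂ)‖ := by
  have := abs_re_le_norm (c + y * I : ℂ)
  simpa [abs_of_nonneg hc] using this

theorem integral_norm_hankelKernel_le {p : ℝ} (hp : 1 < p) (hp2 : p ≤ 2) {s c : ℝ} (hs : 1 ≤ s)
    (hc : 0 < c) : ∫ y : ℝ, ‖hankelKernel p s (c + y * I)‖
      ≤ c ^ (-(p * (s - 1))) * ∫ y : ℝ, ‖hankelKernel p 1 (c + y * I)‖ := by
  rw [← integral_const_mul]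
  exact integral_mono (integrable_hankelKernel_line hp hp2 s hc).norm
    ((integrable_hankelKernel_line hp hp2 1 hc).norm.const_mul _)
    fun y => norm_hankelKernel_le (by linarith) hs hc (le_norm_line hc.le y)

theorem rpow_neg_mul_nat {c : ℝ} (hc : 0 < c) (q : ℝ) (k : ℕ) :
    c ^ (-(q * k)) = ((c ^ q) ^ k)⁻¹ := by
  rw [Real.rpow_neg hc.le, Real.rpow_mul hc.le, Real.rpow_natCast]

theorem summable_pow_mul_inv_Gamma {α : ℝ} (hα : 0 < α) {R : ℝ} (hR : 0 ≤ R) :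
    Summable fun k : ℕ => R ^ k * (Real.Gamma (α * k + 1))⁻¹ := by
  -- Chosen so that c^{2α} = 2R + 1: Hankel's formula with p = 2 then bounds 1/Γ(αk+1) by a constant
  -- times (2R+1)^{-k}, which beats R^k.
  set c : ℝ := (2 * R + 1) ^ (1 / (2 * α)) with hcdef
  have hR' : 0 < 2 * R + 1 := by linarith
  have hc : 0 < c := Real.rpow_pos_of_pos hR' _
  have hcq : c ^ (2 * α) = 2 * R + 1 := by
    rw [hcdef, ← Real.rpow_mul hR'.le, one_div_mul_cancel (by positivity), Real.rpow_one]
  set M := ∫ y : ℝ, ‖hankelKernel 2 1 (c + y * I)‖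
  have hr : R / (2 * R + 1) < 1 := by rw [div_lt_one hR']; linarith
  refine Summable.of_nonneg_of_le (fun k => ?_) (fun k => ?_)
    ((summable_geometric_of_lt_one (by positivity) hr).mul_left M)
  · have : 0 < Real.Gamma (α * k + 1) := Real.Gamma_pos_of_pos (by positivity)
    positivity
  · have hG : 0 < Real.Gamma (α * k + 1) := Real.Gamma_pos_of_pos (by positivity)
    have h1 := vertInt_hankelKernel one_lt_two le_rfl (α * k + 1) hc
    have h2 : ‖vertInt (hankelKernel 2 (α * k + 1)) c‖ ≤ _ := (norm_integral_le_integral_norm _).trans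
      (integral_norm_hankelKernel_le one_lt_two le_rfl (s := α * k + 1)
        (by have : 0 ≤ α * k := by positivity
            linarith) hc)
    rw [h1, add_sub_cancel_right, ← mul_assoc, rpow_neg_mul_nat hc, hcq, norm_mul, norm_mul,
      Complex.norm_real, Complex.norm_real, Real.norm_of_nonneg Real.pi_pos.le,
      Real.norm_of_nonneg (inv_pos.2 hG).le, Complex.norm_ofNat] at h2
    have h3 : (Real.Gamma (α * k + 1))⁻¹ ≤ ((2 * R + 1) ^ k)⁻¹ * M := by
      refine le_trans ?_ h2
      have := Real.pi_gt_three
      have := inv_pos.2 hG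
      nlinarith
    rw [div_pow, div_eq_mul_inv, mul_left_comm, mul_comm M]
    gcongr

theorem norm_mittagLeffler_term {α : ℝ} (hα : 0 < α) (z : ℂ) (k : ℕ) :
    ‖z ^ k / (Real.Gamma (α * k + 1) : ℂ)‖ = ‖z‖ ^ k * (Real.Gamma (α * k + 1))⁻¹ := by
  have hG : 0 < Real.Gamma (α * k + 1) := Real.Gamma_pos_of_pos (by positivity)
  rw [norm_div, norm_pow, Complex.norm_real, Real.norm_of_nonneg hG.le, div_eq_mul_inv]

theorem continuous_mittagLeffler {α : ℝ} (hα : 0 < α) : Continuous (mittagLeffler α) := by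
  rw [continuous_iff_continuousAt]
  intro z
  have hz : Metric.closedBall (0 : ℂ) (‖z‖ + 1) ∈ 𝓝 z :=
    mem_of_superset (Metric.isOpen_ball.mem_nhds (by simp)) Metric.ball_subset_closedBall
  refine ContinuousOn.continuousAt ?_ hz
  refine continuousOn_tsum (fun k => by fun_prop)
    (summable_pow_mul_inv_Gamma hα (R := ‖z‖ + 1) (by positivity)) fun k w hw => ?_
  have hG : 0 < Real.Gamma (α * k + 1) := Real.Gamma_pos_of_pos (by positivity)
  rw [norm_mittagLeffler_term hα]
  have : ‖w‖ ≤ ‖z‖ + 1 := by simpa using hw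
  gcongr

/-! ### The contour integral for E_α -/

/-- The kernel of the contour integral for `E_α`, in the variable `v` with `u = v ^ p`,
`q = p α`. -/
noncomputable def mlKernel (p q : ℝ) (z v : ℂ) : ℂ :=
  p * exp (v ^ (p : ℂ)) * v ^ ((q : ℂ) - 1) / (v ^ (q : ℂ) - z)

theorem hasSum_mlKernel (p α : ℝ) {z v : ℂ} (hv : v ≠ 0) (hz : ‖z‖ < ‖v‖ ^ (p * α)) :
    HasSum (fun k : ℕ => z ^ k * hankelKernel p (α * k + 1) v) (mlKernel p (p * α) z v) := by
  have hvq : v ^ ((p * α : ℝ) : ℂ) ≠ 0 := by simp [hv]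
  have hlt : ‖z / v ^ ((p * α : ℝ) : ℂ)‖ < 1 := by
    rw [norm_div, norm_cpow_real, div_lt_one (lt_of_le_of_lt (norm_nonneg _) hz)]
    exact hz
  have h1 := (hasSum_geometric_of_norm_lt_one hlt).mul_left (p * exp (v ^ (p : ℂ)) * v⁻¹)
  have hne : v ^ ((p * α : ℝ) : ℂ) - z ≠ 0 := by
    intro h
    rw [← sub_eq_zero.1 h, div_self hvq] at hlt
    simp at hlt
  convert! h1 using 1
  · ext k
    rw [hankelKernel, show ((p * (1 - (α * k + 1)) - 1 : ℝ) : ℂ)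
      = -1 - (k : ℂ) * ((p * α : ℝ) : ℂ) by push_cast; ring, cpow_sub _ _ hv, cpow_neg_one,
      cpow_nat_mul, div_pow]
    ring
  · rw [mlKernel, cpow_sub _ _ hv, cpow_one]
    field_simp

/-- Each 1/Γ(αk+1) is replaced by its Hankel integral. Since |z| < c^{pα} ≤ |v|^{pα} on the line,
the geometric series may be summed under the integral. -/
theorem mittagLeffler_eq_vertInt {p α : ℝ} (hp : 1 < p) (hp2 : p ≤ 2) (hα : 0 < α) {c : ℝ}
    (hc : 0 < c) {z : ℂ} (hz : ‖z‖ < c ^ (p * α)) :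
    mittagLeffler α z = (2 * (Real.pi : ℂ))⁻¹ * vertInt (mlKernel p (p * α) z) c := by
  have hcq : 0 < c ^ (p * α) := Real.rpow_pos_of_pos hc _
  have hs := hasSum_integral_of_summable_integral_norm
    (F := fun (k : ℕ) (y : ℝ) => z ^ k * hankelKernel p (α * k + 1) (c + y * I)) (μ := volume)
    (fun k => (integrable_hankelKernel_line hp hp2 _ hc).const_mul _) ?_
  · have e1 : ∀ k : ℕ, ∫ y : ℝ, z ^ k * hankelKernel p (α * k + 1) (c + y * I)
        = 2 * Real.pi * (z ^ k / (Real.Gamma (α * k + 1) : ℂ)) := by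
      intro k
      have := vertInt_hankelKernel hp hp2 (α * k + 1) hc
      rw [vertInt] at this
      rw [integral_const_mul, this, ofReal_inv]
      ring
    have e2 : ∀ y : ℝ, ∑' k : ℕ, z ^ k * hankelKernel p (α * k + 1) (c + y * I)
        = mlKernel p (p * α) z (c + y * I) := by
      intro y
      refine (hasSum_mlKernel p α (ne_zero_of_re_pos (by simpa using hc)) (hz.trans_le ?_)).tsum_eq
      have : 0 < p * α := by nlinarith
      exact Real.rpow_le_rpow hc.le (le_norm_line hc.le y) this.le
    simp only [e1, e2] at hs
    have hs' := hs.tsum_eq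
    rw [tsum_mul_left] at hs'
    have hπ : (2 * Real.pi : ℂ) ≠ 0 := by simp [Real.pi_ne_zero]
    rw [vertInt, ← hs', ← mul_assoc, inv_mul_cancel₀ hπ, one_mul]
    rfl
  · have hlt : ‖z‖ / c ^ (p * α) < 1 := by rwa [div_lt_one hcq]
    refine Summable.of_nonneg_of_le (fun k => integral_nonneg fun y => norm_nonneg _) (fun k => ?_)
      ((summable_geometric_of_lt_one (by positivity) hlt).mul_right
        (∫ y : ℝ, ‖hankelKernel p 1 (c + y * I)‖))
    have h0 : 0 ≤ α * k := by positivity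
    have := integral_norm_hankelKernel_le hp hp2 (s := α * k + 1) (by linarith) hc
    rw [add_sub_cancel_right, ← mul_assoc, rpow_neg_mul_nat hc] at this
    simp only [norm_mul, norm_pow]
    rw [integral_const_mul, div_pow, div_eq_mul_inv, mul_assoc]
    gcongr

/-- On the closed right half-plane |q·arg v| ≤ qπ/2 < π, so q log v stays in the strip where exp is
injective. Hence the kernel has at most one pole there. -/
theorem eq_of_cpow_eq {q : ℝ} (hq : 0 < q) (hq2 : q < 2) {v w : ℂ} (hv : 0 ≤ v.re) (hw : 0 ≤ w.re)
    (h : v ^ (q : ℂ) = w ^ (q : ℂ)) : v = w := by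
  have hq' : (q : ℂ) ≠ 0 := ofReal_ne_zero.2 hq.ne'
  have hπ := Real.pi_pos
  rcases eq_or_ne v 0 with rfl | hv0
  · rw [zero_cpow hq', eq_comm, cpow_eq_zero_iff] at h
    exact h.1.symm
  rcases eq_or_ne w 0 with rfl | hw0
  · rw [zero_cpow hq', cpow_eq_zero_iff] at h
    exact h.1
  rw [cpow_def_of_ne_zero hv0, cpow_def_of_ne_zero hw0] at h
  have hb : ∀ u : ℂ, 0 ≤ u.re → -Real.pi < (log u * q).im ∧ (log u * q).im ≤ Real.pi := by
    intro u hu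
    have := abs_le.1 (Complex.abs_arg_le_pi_div_two_iff.2 hu)
    rw [im_mul_ofReal, log_im]
    constructor <;> nlinarith
  have h2 := Complex.exp_inj_of_neg_pi_lt_of_le_pi (hb v hv).1 (hb v hv).2 (hb w hw).1 (hb w hw).2 h
  rw [← exp_log hv0, ← exp_log hw0, mul_right_cancel₀ hq' h2]

theorem norm_mlKernel {p : ℝ} (hp : 0 ≤ p) (q : ℝ) (z v : ℂ) :
    ‖mlKernel p q z v‖
      = p * (‖exp (v ^ (p : ℂ))‖ * ‖v‖ ^ (q - 1)) / ‖v ^ (q : ℂ) - z‖ := by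
  rw [mlKernel, norm_div, norm_mul, norm_mul, norm_real, Real.norm_of_nonneg hp, mul_assoc,
    show (q : ℂ) - 1 = ((q - 1 : ℝ) : ℂ) by push_cast; rfl, norm_cpow_real]

theorem stripDecay_mlKernel {p q : ℝ} (hp : 1 < p) (hp2 : p ≤ 2) (hq : 0 < q) (z : ℂ) {a : ℝ}
    (ha : 0 ≤ a) (b : ℝ) : StripDecay (mlKernel p q z) a b := by
  refine stripDecay_of_norm_le hp hp2 ha p (q - 1) ((‖z‖ + 1) ^ (1 / q)) fun v _ _ h => ?_
  have h1 : ‖z‖ + 1 ≤ ‖v ^ (q : ℂ)‖ := by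
    rw [norm_cpow_real]
    calc ‖z‖ + 1 = ((‖z‖ + 1) ^ (1 / q)) ^ q := by
          rw [← Real.rpow_mul (by positivity), one_div_mul_cancel hq.ne', Real.rpow_one]
      _ ≤ _ := Real.rpow_le_rpow (by positivity) (h.trans (abs_im_le_norm v)) hq.le
  have h2 : 1 ≤ ‖v ^ (q : ℂ) - z‖ := by
    have := norm_sub_norm_le (v ^ (q : ℂ)) z
    linarith
  rw [norm_mlKernel (by linarith)]
  exact div_le_self (by positivity) h2

theorem differentiableAt_mlKernel (p q : ℝ) {z v : ℂ} (hv : 0 < v.re) (hz : v ^ (q : ℂ) ≠ z) :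
    DifferentiableAt ℂ (mlKernel p q z) v := by
  have := mem_slitPlane_of_re_pos hv
  unfold mlKernel
  refine DifferentiableAt.div ?_ ?_ (sub_ne_zero.2 hz) <;> fun_prop (disch := assumption)

theorem integrable_mlKernel_line {p q : ℝ} (hp : 1 < p) (hp2 : p ≤ 2) (hq : 0 < q) {z : ℂ}
    {c : ℝ} (hc : 0 < c) (hz : ∀ v : ℂ, v.re = c → v ^ (q : ℂ) ≠ z) :
    Integrable fun y : ℝ => mlKernel p q z (c + y * I) :=
  (stripDecay_mlKernel hp hp2 hq z hc.le c).integrable le_rfl le_rfl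
    (continuous_line_of_continuousAt fun v hv =>
      (differentiableAt_mlKernel p q (hv ▸ hc) (hz v hv)).continuousAt)

/-- The contour integral for `E_α(z)` when the integrand has no pole. -/
theorem mittagLeffler_eq_vertInt_one {p α : ℝ} (hp : 1 < p) (hp2 : p ≤ 2) (hα : 0 < α) {z : ℂ}
    (hz : ∀ v : ℂ, 0 < v.re → v ^ ((p * α : ℝ) : ℂ) ≠ z) :
    mittagLeffler α z = (2 * (Real.pi : ℂ))⁻¹ * vertInt (mlKernel p (p * α) z) 1 := by
  have hq : 0 < p * α := by nlinarith
  set c : ℝ := (‖z‖ + 1) ^ (1 / (p * α)) with hcdef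
  have hc1 : 1 ≤ c := Real.one_le_rpow (by linarith [norm_nonneg z]) (by positivity)
  have hcq : ‖z‖ < c ^ (p * α) := by
    rw [hcdef, ← Real.rpow_mul (by positivity), one_div_mul_cancel hq.ne', Real.rpow_one]
    linarith
  rw [mittagLeffler_eq_vertInt hp hp2 hα (by linarith) hcq]
  congr 1
  have hd : ∀ v : ℂ, 1 ≤ v.re → DifferentiableAt ℂ (mlKernel p (p * α) z) v := fun v hv =>
    differentiableAt_mlKernel p _ (by linarith) (hz v (by linarith))
  exact (vertInt_eq_of_stripDecay hc1 (fun v hv => (hd v hv.1).continuousAt.continuousWithinAt)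
    (fun v hv _ => hd v hv.le) (stripDecay_mlKernel hp hp2 hq z zero_le_one c)).symm

/-! ### The residue at the pole -/

/-- A rapidly decaying function with a simple pole of residue `1` at `w`. -/
noncomputable def gaussPole (w v : ℂ) : ℂ := exp ((v - w) ^ 2) / (v - w)

theorem gaussPole_eq_hankelKernel (w v : ℂ) : gaussPole w v = hankelKernel 2 1 (v - w) / 2 := by
  have h : (((2 : ℝ) * (1 - 1) - 1 : ℝ) : ℂ) = -1 := by push_cast; ring
  rw [gaussPole, hankelKernel, h, cpow_neg_one, ofReal_ofNat, cpow_ofNat]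
  ring

/-- After translation by w this is half of Hankel's formula with p = 2, s = 1. -/
theorem vertInt_gaussPole_right {w : ℂ} {c : ℝ} (hc : w.re < c) :
    vertInt (gaussPole w) c = Real.pi := by
  have h := vertInt_hankelKernel one_lt_two le_rfl 1 (sub_pos.2 hc)
  rw [vertInt, ← integral_sub_right_eq_self _ w.im] at h
  have e : ∀ y : ℝ, ((c - w.re : ℝ) : ℂ) + ((y - w.im : ℝ) : ℂ) * I = c + y * I - w := by
    intro y
    apply Complex.ext <;> simp
  simp only [e] at h
  simp only [vertInt, gaussPole_eq_hankelKernel]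
  rw [integral_div, h]
  simp

/-- The point reflection v ↦ 2w - v changes the sign of `gaussPole` and carries the line to the
other side of w. -/
theorem vertInt_gaussPole_left {w : ℂ} {c : ℝ} (hc : c < w.re) :
    vertInt (gaussPole w) c = -Real.pi := by
  have h := vertInt_gaussPole_right (w := w) (c := 2 * w.re - c) (by linarith)
  rw [vertInt, ← integral_sub_left_eq_self _ _ (2 * w.im)] at h
  rw [← h, ← integral_neg, vertInt]
  congr 1
  ext y
  have e : ((2 * w.re - c : ℝ) : ℂ) + ((2 * w.im - y : ℝ) : ℂ) * I - w = -(c + y * I - w) := by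
    apply Complex.ext <;> simp <;> ring
  rw [gaussPole, gaussPole, e, neg_sq, div_neg, neg_neg]

theorem stripDecay_gaussPole (w : ℂ) (a b : ℝ) : StripDecay (gaussPole w) a b := by
  refine ⟨2 * (1 + w.im ^ 2) * Real.exp ((|a| + |b| + |w.re|) ^ 2), |w.im| + 1, fun v h1 h2 h3 => ?_⟩
  have hre : (v.re - w.re) ^ 2 ≤ (|a| + |b| + |w.re|) ^ 2 := by
    rw [sq_le_sq, abs_of_nonneg (by positivity : 0 ≤ |a| + |b| + |w.re|), abs_le]
    constructor <;> linarith [neg_abs_le a, le_abs_self b, le_abs_self w.re, neg_abs_le w.re,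
      abs_nonneg a, abs_nonneg b]
  have him : 1 ≤ |v.im - w.im| := by
    linarith [abs_sub_abs_le_abs_sub v.im w.im]
  have hn : 1 ≤ ‖v - w‖ := him.trans (by simpa using abs_im_le_norm (v - w))
  have e1 : ((v - w) ^ 2).re = (v.re - w.re) ^ 2 - (v.im - w.im) ^ 2 := by
    simp [sq]
  rw [gaussPole, norm_div, Complex.norm_exp, e1, Real.exp_sub]
  refine (div_le_self (by positivity) hn).trans ?_
  have h4 : 1 + (v.im - w.im) ^ 2 ≤ Real.exp ((v.im - w.im) ^ 2) := by
    linarith [Real.add_one_le_exp ((v.im - w.im) ^ 2)]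
  have h5 : 1 + v.im ^ 2 ≤ 2 * (1 + w.im ^ 2) * Real.exp ((v.im - w.im) ^ 2) := by
    refine le_trans ?_ (mul_le_mul_of_nonneg_left h4 (by positivity))
    nlinarith [sq_nonneg (v.im - 2 * w.im), mul_nonneg (sq_nonneg w.im) (sq_nonneg (v.im - w.im)),
      sq_nonneg v.im]
  rw [← div_eq_mul_inv, div_le_div_iff₀ (Real.exp_pos _) (by positivity)]
  calc Real.exp ((v.re - w.re) ^ 2) * (1 + v.im ^ 2)
      ≤ Real.exp ((|a| + |b| + |w.re|) ^ 2) *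
        (2 * (1 + w.im ^ 2) * Real.exp ((v.im - w.im) ^ 2)) := by
        gcongr
    _ = _ := by ring

theorem integrable_gaussPole_line {w : ℂ} {c : ℝ} (hc : c ≠ w.re) :
    Integrable fun y : ℝ => gaussPole w (c + y * I) := by
  refine (stripDecay_gaussPole w c c).integrable le_rfl le_rfl
    (continuous_line_of_continuousAt fun v hv => ?_)
  have : v - w ≠ 0 := by
    intro h
    rw [sub_eq_zero.1 h] at hv
    exact hc hv.symm
  unfold gaussPole
  exact ContinuousAt.div (by fun_prop) (by fun_prop) this

theorem StripDecay.sub_const_mul {f g : ℂ → ℂ} {a b : ℝ} (hf : StripDecay f a b)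
    (hg : StripDecay g a b) (A : ℂ) : StripDecay (fun v => f v - A * g v) a b := by
  obtain ⟨C, Y, hf⟩ := hf
  obtain ⟨D, Z, hg⟩ := hg
  refine ⟨C + ‖A‖ * D, max Y Z, fun v h1 h2 h3 => ?_⟩
  have i1 := hf v h1 h2 ((le_max_left _ _).trans h3)
  have i2 := hg v h1 h2 ((le_max_right _ _).trans h3)
  calc ‖f v - A * g v‖ ≤ ‖f v‖ + ‖A‖ * ‖g v‖ := by
        rw [← norm_mul]; exact norm_sub_le _ _
    _ ≤ C * (1 + v.im ^ 2)⁻¹ + ‖A‖ * (D * (1 + v.im ^ 2)⁻¹) := by gcongr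
    _ = _ := by ring

theorem StripDecay.congr {f g : ℂ → ℂ} {a b : ℝ} (hf : StripDecay f a b) (w : ℂ)
    (h : ∀ v, v ≠ w → f v = g v) : StripDecay g a b := by
  obtain ⟨C, Y, hf⟩ := hf
  refine ⟨C, max Y (|w.im| + 1), fun v h1 h2 h3 => ?_⟩
  rw [← h v]
  · exact hf v h1 h2 ((le_max_left _ _).trans h3)
  · rintro rfl
    have := (le_max_right _ _).trans h3
    linarith

/-- The residue of `mlKernel` at its pole, as a difference of vertical integrals. -/
theorem vertInt_mlKernel_sub {p q : ℝ} (hp : 1 < p) (hp2 : p ≤ 2) (hq : 0 < q) (hq2 : q < 2) {w : ℂ}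
    {a b : ℝ} (ha : 0 < a) (haw : a < w.re) (hwb : w.re < b) :
    vertInt (mlKernel p q (w ^ (q : ℂ))) b - vertInt (mlKernel p q (w ^ (q : ℂ))) a
      = 2 * Real.pi * (p / q * exp (w ^ (p : ℂ))) := by
  set z := w ^ (q : ℂ) with hz
  set A := p / q * exp (w ^ (p : ℂ)) with hA
  have hwre : 0 < w.re := ha.trans haw
  have hw0 : w ≠ 0 := ne_zero_of_re_pos hwre
  have hq' : (q : ℂ) ≠ 0 := ofReal_ne_zero.2 hq.ne'
  set U : Set ℂ := {v | 0 < v.re} with hU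
  have hUo : IsOpen U := isOpen_lt continuous_const continuous_re
  have hUw : U ∈ 𝓝 w := hUo.mem_nhds hwre
  -- The difference quotient of v^q at w is holomorphic, and it has no zero in the half-plane
  -- because v^q is injective there and its derivative at w is nonzero.
  set D : ℂ → ℂ := dslope (fun v => v ^ (q : ℂ)) w with hD
  have hDd : DifferentiableOn ℂ D U := by
    rw [hD, differentiableOn_dslope hUw]
    intro v hv
    have := mem_slitPlane_of_re_pos hv
    exact DifferentiableAt.differentiableWithinAt (by fun_prop (disch := assumption))
  have hDw : D w = q * w ^ ((q : ℂ) - 1) := by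
    rw [hD, dslope_same]
    simpa using ((hasDerivAt_id w).cpow_const (mem_slitPlane_of_re_pos hwre)).deriv
  have hDne : ∀ v, v ≠ w → D v = (v ^ (q : ℂ) - z) / (v - w) := by
    intro v hv
    rw [hD, dslope_of_ne _ hv, slope_def_field]
  have hpole : ∀ v : ℂ, 0 < v.re → v ≠ w → v ^ (q : ℂ) ≠ z := fun v hv hvw h =>
    hvw (eq_of_cpow_eq hq hq2 hv.le hwre.le h)
  have hD0 : ∀ v ∈ U, D v ≠ 0 := by
    intro v hv
    rcases eq_or_ne v w with rfl | hvw
    · rw [hDw]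
      simp [hq', hw0]
    · rw [hDne v hvw]
      exact div_ne_zero (sub_ne_zero.2 (hpole v hv hvw)) (sub_ne_zero.2 hvw)
  -- This is (v - w) times the kernel minus A times `gaussPole`. It vanishes at w since A is the
  -- residue, so `dslope k w` extends the difference holomorphically across w. The shift then costs
  -- only the jump of the `gaussPole` integral, π - (-π) = 2π.
  set k : ℂ → ℂ := fun v => p * exp (v ^ (p : ℂ)) * v ^ ((q : ℂ) - 1) / D v
    - A * exp ((v - w) ^ 2) with hk
  have hkd : DifferentiableOn ℂ k U := by
    refine DifferentiableOn.sub (DifferentiableOn.div ?_ hDd hD0) (by fun_prop)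
    intro v hv
    have := mem_slitPlane_of_re_pos hv
    exact DifferentiableAt.differentiableWithinAt (by fun_prop (disch := assumption))
  have hkw : k w = 0 := by
    have : w ^ ((q : ℂ) - 1) ≠ 0 := by simp [hw0]
    simp only [hk, hDw, hA, sub_self]
    simp
    field_simp
    ring
  have hΦ : ∀ v, v ≠ w → mlKernel p q z v - A * gaussPole w v = dslope k w v := by
    intro v hv
    have hvw := sub_ne_zero.2 hv
    rw [dslope_of_ne _ hv, slope_def_field, hkw, hk, mlKernel, gaussPole]
    simp only [hDne v hv]
    rw [div_div_eq_mul_div, sub_zero, sub_div, mul_div_right_comm _ (v - w),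
      mul_div_cancel_right₀ _ hvw, mul_div_assoc A]
  have hΦd : DifferentiableOn ℂ (dslope k w) U := (differentiableOn_dslope hUw).2 hkd
  have hΦd' : ∀ v : ℂ, 0 < v.re → DifferentiableAt ℂ (dslope k w) v := fun v hv =>
    (hΦd v hv).differentiableAt (hUo.mem_nhds hv)
  have hdec : StripDecay (dslope k w) a b :=
    ((stripDecay_mlKernel hp hp2 hq z ha.le b).sub_const_mul (stripDecay_gaussPole w a b) A).congr
      w hΦ
  have hshift := vertInt_eq_of_stripDecay (by linarith)
    (fun v hv => (hΦd' v (ha.trans_le hv.1)).continuousAt.continuousWithinAt)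
    (fun v hv _ => hΦd' v (ha.trans hv)) hdec
  have hline : ∀ c : ℝ, 0 < c → c ≠ w.re → vertInt (dslope k w) c
      = vertInt (mlKernel p q z) c - A * vertInt (gaussPole w) c := by
    intro c hc hcw
    have hne : ∀ v : ℂ, v.re = c → v ≠ w := by
      rintro v hv rfl
      exact hcw hv.symm
    rw [vertInt, vertInt, vertInt, ← integral_const_mul, ← integral_sub
      (integrable_mlKernel_line hp hp2 hq hc fun v hv => hpole v (hv ▸ hc) (hne v hv))
      ((integrable_gaussPole_line hcw).const_mul A)]
    exact integral_congr_ae (Eventually.of_forall fun y => (hΦ _ (hne _ (by simp))).symm)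
  rw [hline a ha haw.ne, hline b (by linarith) hwb.ne', vertInt_gaussPole_left haw,
    vertInt_gaussPole_right hwb] at hshift
  linear_combination -hshift

/-- The contour integral for `E_α(z)` when the integrand has a pole at `w`, `z = w ^ (p α)`. -/
theorem mittagLeffler_cpow_eq {p α : ℝ} (hp : 1 < p) (hp2 : p < 2) (hα : 0 < α) (hα1 : α ≤ 1)
    {w : ℂ} (hw : 1 < w.re) :
    mittagLeffler α (w ^ ((p * α : ℝ) : ℂ)) = 1 / α * exp (w ^ (p : ℂ))
      + (2 * (Real.pi : ℂ))⁻¹ * vertInt (mlKernel p (p * α) (w ^ ((p * α : ℝ) : ℂ))) 1 := by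
  have hq : 0 < p * α := by nlinarith
  have hc : ‖w ^ ((p * α : ℝ) : ℂ)‖ < (‖w‖ + 1) ^ (p * α) := by
    rw [norm_cpow_real]
    exact Real.rpow_lt_rpow (norm_nonneg _) (by linarith) hq
  have hwc : w.re < ‖w‖ + 1 := by linarith [re_le_norm w]
  have hpc : (p : ℂ) ≠ 0 := ofReal_ne_zero.2 (by linarith)
  have hαc : (α : ℂ) ≠ 0 := ofReal_ne_zero.2 hα.ne'
  have hπ : (Real.pi : ℂ) ≠ 0 := ofReal_ne_zero.2 Real.pi_ne_zero
  have h := vertInt_mlKernel_sub hp hp2.le hq (by nlinarith) one_pos hw hwc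
  rw [mittagLeffler_eq_vertInt hp hp2.le hα (by linarith [norm_nonneg w]) hc,
    sub_eq_iff_eq_add.1 h]
  push_cast
  field_simp

/-! ### Asymptotics of E_α along rays -/

/-- On a large disc this is compactness; outside it |v^q| ≥ |ζ| + 1. -/
theorem exists_le_norm_cpow_sub {q : ℝ} (hq : 0 < q) {S : Set ℂ} (hS : IsClosed S)
    (hre : ∀ v ∈ S, 0 ≤ v.re) {ζ : ℂ} (hζ : ∀ v ∈ S, v ^ (q : ℂ) ≠ ζ) :
    ∃ κ : ℝ, 0 < κ ∧ ∀ v ∈ S, κ ≤ ‖v ^ (q : ℂ) - ζ‖ := by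
  set R : ℝ := (‖ζ‖ + 1) ^ (1 / q)
  have hK : IsCompact (S ∩ Metric.closedBall 0 R) := (isCompact_closedBall 0 R).inter_left hS
  have hcont : ContinuousOn (fun v : ℂ => ‖v ^ (q : ℂ) - ζ‖) (S ∩ Metric.closedBall 0 R) :=
    fun v hv => ContinuousAt.continuousWithinAt <| ContinuousAt.norm <| ContinuousAt.sub
      (continuousAt_cpow_const_of_re_pos (Or.inl (hre v hv.1)) (by simpa using hq))
      continuousAt_const
  obtain ⟨κ, hκ, h⟩ := hK.exists_forall_le' hcont (a := 0)
    fun v hv => norm_pos_iff.2 (sub_ne_zero.2 (hζ v hv.1))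
  refine ⟨min κ 1, lt_min hκ one_pos, fun v hv => ?_⟩
  by_cases hvR : ‖v‖ ≤ R
  · exact (min_le_left _ _).trans (h v ⟨hv, by simpa using hvR⟩)
  · refine (min_le_right _ _).trans ?_
    have h1 : ‖ζ‖ + 1 ≤ ‖v ^ (q : ℂ)‖ := by
      rw [norm_cpow_real]
      calc ‖ζ‖ + 1 = R ^ q := by
            rw [← Real.rpow_mul (by positivity), one_div_mul_cancel hq.ne', Real.rpow_one]
        _ ≤ _ := Real.rpow_le_rpow (by positivity) (not_le.1 hvR).le hq.le
    linarith [norm_sub_norm_le (v ^ (q : ℂ)) ζ]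

/-- Homogeneity reduces a lower bound uniform in r to the single point ζ. -/
theorem norm_cpow_sub_mul {q : ℝ} (hq : 0 < q) {r : ℝ} (hr : 0 < r) (v ζ : ℂ) :
    ‖v ^ (q : ℂ) - r * ζ‖ = r * ‖(((r ^ (-(1 / q)) : ℝ) : ℂ) * v) ^ (q : ℂ) - ζ‖ := by
  have hq' : (q : ℂ) ≠ 0 := ofReal_ne_zero.2 hq.ne'
  have hx : 0 < r ^ (-(1 / q)) := Real.rpow_pos_of_pos hr _
  have h1 : (((r ^ (-(1 / q)) : ℝ) : ℂ) * v) ^ (q : ℂ) = (r : ℂ)⁻¹ * v ^ (q : ℂ) := by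
    rcases eq_or_ne v 0 with rfl | hv
    · simp [zero_cpow hq']
    · rw [ofReal_mul_cpow hx hv, ← ofReal_cpow hx.le, ← Real.rpow_mul hr.le, neg_mul,
        one_div_mul_cancel hq.ne', Real.rpow_neg_one, ofReal_inv]
  have hr' : (r : ℂ) ≠ 0 := ofReal_ne_zero.2 hr.ne'
  rw [h1]
  nth_rewrite 2 [← Real.norm_of_nonneg hr.le]
  rw [← Complex.norm_real, ← norm_mul, mul_sub, mul_inv_cancel_left₀ hr']

theorem mlKernel_eq_hankelKernel_div (p α : ℝ) (z v : ℂ) :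
    mlKernel p (p * α) z v = hankelKernel p (1 - α) v / (v ^ ((p * α : ℝ) : ℂ) - z) := by
  rw [mlKernel, hankelKernel]
  congr 3
  push_cast
  ring

theorem norm_vertInt_le_of_le_div {p s κ : ℝ} (hp : 1 < p) (hp2 : p ≤ 2) {f : ℂ → ℂ}
    (hf : ∀ v : ℂ, v.re = 1 → ‖f v‖ ≤ ‖hankelKernel p s v‖ / κ) :
    ‖vertInt f 1‖ ≤ (∫ y : ℝ, ‖hankelKernel p s ((1 : ℝ) + y * I)‖) / κ := by
  rw [← integral_div]
  exact norm_integral_le_of_norm_le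
    ((integrable_hankelKernel_line hp hp2 s one_pos).norm.div_const κ)
    (Eventually.of_forall fun y => hf _ (by simp))

theorem norm_vertInt_mlKernel_le {p α r κ : ℝ} (hp : 1 < p) (hp2 : p ≤ 2) (hκ : 0 < κ) (hr : 0 < r)
    {ζ : ℂ} (h : ∀ v : ℂ, v.re = 1 → r * κ ≤ ‖v ^ ((p * α : ℝ) : ℂ) - r * ζ‖) :
    ‖vertInt (mlKernel p (p * α) (r * ζ)) 1‖
      ≤ (∫ y : ℝ, ‖hankelKernel p (1 - α) ((1 : ℝ) + y * I)‖) / (r * κ) := by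
  refine norm_vertInt_le_of_le_div hp hp2 fun v hv => ?_
  rw [mlKernel_eq_hankelKernel_div, norm_div]
  exact div_le_div_of_nonneg_left (norm_nonneg _) (by positivity) (h v hv)

/-- Algebraic asymptotics of `E_α` along the ray through `ζ`. -/
theorem exists_norm_mittagLeffler_add_le {p α : ℝ} (hp : 1 < p) (hp2 : p ≤ 2) (hα : 0 < α)
    {ζ : ℂ} (hζ : ∀ v : ℂ, 0 ≤ v.re → v ^ ((p * α : ℝ) : ℂ) ≠ ζ) :
    ∃ C : ℝ, ∀ r : ℝ, 0 < r →
      ‖mittagLeffler α (r * ζ) + (r * ζ)⁻¹ * ((Real.Gamma (1 - α))⁻¹ : ℝ)‖ ≤ C * (r ^ 2)⁻¹ := by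
  have hq : 0 < p * α := by nlinarith
  have hζ0 : ζ ≠ 0 := by
    have := hζ 0 (by simp)
    rw [zero_cpow (ofReal_ne_zero.2 hq.ne')] at this
    exact this.symm
  obtain ⟨κ, hκ, h⟩ := exists_le_norm_cpow_sub hq (isClosed_le continuous_const continuous_re)
    (fun v hv => hv) hζ
  set M : ℝ := ∫ y : ℝ, ‖hankelKernel p (1 - 2 * α) ((1 : ℝ) + y * I)‖
  refine ⟨(2 * Real.pi)⁻¹ * (M / (‖ζ‖ * κ)), fun r hr => ?_⟩
  have hr0 : (r : ℂ) ≠ 0 := ofReal_ne_zero.2 hr.ne'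
  have hz0 : (r : ℂ) * ζ ≠ 0 := mul_ne_zero hr0 hζ0
  have hlow : ∀ v : ℂ, 0 ≤ v.re → r * κ ≤ ‖v ^ ((p * α : ℝ) : ℂ) - r * ζ‖ := by
    intro v hv
    rw [norm_cpow_sub_mul hq hr]
    refine mul_le_mul_of_nonneg_left (h _ ?_) hr.le
    have : 0 ≤ r ^ (-(1 / (p * α))) * v.re := by positivity
    simpa using this
  have hne : ∀ v : ℂ, 0 ≤ v.re → v ^ ((p * α : ℝ) : ℂ) ≠ r * ζ := by
    intro v hv h0
    have := hlow v hv
    rw [h0, sub_self, norm_zero] at this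
    nlinarith
  rw [mittagLeffler_eq_vertInt_one hp hp2 hα fun v hv => hne v hv.le]
  set z : ℂ := r * ζ with hz
  -- Adding the leading term uses 1/(T - z) + 1/z = T/(z(T - z)) with T = v^{pα}. The factor T turns
  -- the parameter 1 - α into 1 - 2α, and the denominator is now of order r².
  set f : ℂ → ℂ := fun v => mlKernel p (p * α) z v + z⁻¹ * hankelKernel p (1 - α) v with hf
  have hfv : vertInt f 1 = vertInt (mlKernel p (p * α) z) 1
      + z⁻¹ * (2 * Real.pi * ((Real.Gamma (1 - α))⁻¹ : ℝ)) := by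
    rw [← vertInt_hankelKernel hp hp2 (1 - α) one_pos, vertInt, vertInt, vertInt,
      ← integral_const_mul, ← integral_add]
    · exact integrable_mlKernel_line hp hp2 hq one_pos fun v hv => hne v (hv ▸ zero_le_one)
    · exact (integrable_hankelKernel_line hp hp2 _ one_pos).const_mul _
  have hfb : ‖vertInt f 1‖ ≤ M / (‖z‖ * (r * κ)) := by
    refine norm_vertInt_le_of_le_div hp hp2 fun v hv => ?_
    have hv0 : v ≠ 0 := ne_zero_of_re_pos (hv ▸ one_pos)
    have h1 : v ^ ((p * α : ℝ) : ℂ) - z ≠ 0 := sub_ne_zero.2 (hne v (hv ▸ zero_le_one))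
    have h2 : hankelKernel p (1 - 2 * α) v
        = v ^ ((p * α : ℝ) : ℂ) * hankelKernel p (1 - α) v := by
      rw [hankelKernel, hankelKernel, mul_left_comm, ← cpow_add _ _ hv0]
      congr 2
      push_cast
      ring
    have h3 : f v = hankelKernel p (1 - 2 * α) v / (z * (v ^ ((p * α : ℝ) : ℂ) - z)) := by
      rw [hf, h2]
      simp only [mlKernel_eq_hankelKernel_div]
      generalize v ^ ((p * α : ℝ) : ℂ) = T at h1 ⊢
      field_simp
      ring
    rw [h3, norm_div, norm_mul]
    exact div_le_div_of_nonneg_left (norm_nonneg _) (by positivity)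
      (mul_le_mul_of_nonneg_left (hlow v (hv ▸ zero_le_one)) (norm_nonneg _))
  have hπ : (Real.pi : ℂ) ≠ 0 := ofReal_ne_zero.2 Real.pi_ne_zero
  have e : (2 * (Real.pi : ℂ))⁻¹ * vertInt (mlKernel p (p * α) z) 1
      + z⁻¹ * ((Real.Gamma (1 - α))⁻¹ : ℝ) = (2 * (Real.pi : ℂ))⁻¹ * vertInt f 1 := by
    rw [hfv]
    field_simp
  rw [e, norm_mul, norm_inv, norm_mul, norm_ofNat, norm_real, Real.norm_of_nonneg Real.pi_pos.le]
  refine (mul_le_mul_of_nonneg_left hfb (by positivity)).trans_eq ?_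
  rw [hz, norm_mul, norm_real, Real.norm_of_nonneg hr.le]
  field_simp

/-- Exponential asymptotics of `E_α` along the ray through `w ^ (p α)`. -/
theorem exists_norm_mittagLeffler_sub_exp_le {p α : ℝ} (hp : 1 < p) (hp2 : p < 2) (hα : 0 < α)
    (hα1 : α ≤ 1) {w : ℂ} (hw : 0 < w.re) :
    ∃ C R : ℝ, 0 < R ∧ ∀ r : ℝ, R ≤ r →
      ‖mittagLeffler α (r * w ^ ((p * α : ℝ) : ℂ))
        - 1 / α * exp (((r ^ (1 / α) : ℝ) : ℂ) * w ^ (p : ℂ))‖ ≤ C * r⁻¹ := by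
  have hq : 0 < p * α := by nlinarith
  have hq2 : p * α < 2 := by nlinarith
  have hw0 := ne_zero_of_re_pos hw
  -- Rescaling by r^{-1/(pα)} sends the line Re v = 1 into this strip once r ≥ R, and w lies outside
  -- it.
  have hcl : IsClosed {v : ℂ | 0 ≤ v.re ∧ v.re ≤ w.re / 2} :=
    (isClosed_le continuous_const continuous_re).inter (isClosed_le continuous_re continuous_const)
  obtain ⟨κ, hκ, h⟩ := exists_le_norm_cpow_sub hq hcl (fun v hv => hv.1)
    (ζ := w ^ ((p * α : ℝ) : ℂ)) fun v hv h0 => by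
      have h1 := hv.2
      rw [eq_of_cpow_eq hq hq2 hv.1 hw.le h0] at h1
      linarith
  set M : ℝ := ∫ y : ℝ, ‖hankelKernel p (1 - α) ((1 : ℝ) + y * I)‖
  set R : ℝ := (2 / w.re) ^ (p * α)
  refine ⟨(2 * Real.pi)⁻¹ * (M / κ), R, by positivity, fun r hrR => ?_⟩
  have hr : 0 < r := lt_of_lt_of_le (by positivity) hrR
  set x : ℝ := r ^ (1 / (p * α)) with hx
  have hx0 : 0 < x := Real.rpow_pos_of_pos hr _
  have hxw : 2 / w.re ≤ x := by
    calc 2 / w.re = R ^ (1 / (p * α)) := by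
          rw [← Real.rpow_mul (by positivity), mul_one_div_cancel hq.ne', Real.rpow_one]
      _ ≤ _ := Real.rpow_le_rpow (by positivity) hrR (by positivity)
  have hxq : x ^ (p * α) = r := by
    rw [hx, ← Real.rpow_mul hr.le, one_div_mul_cancel hq.ne', Real.rpow_one]
  have hxp : x ^ p = r ^ (1 / α) := by
    rw [hx, ← Real.rpow_mul hr.le]
    congr 1
    field_simp
  have hlow : ∀ v : ℂ, v.re = 1 →
      r * κ ≤ ‖v ^ ((p * α : ℝ) : ℂ) - r * w ^ ((p * α : ℝ) : ℂ)‖ := by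
    intro v hv
    rw [norm_cpow_sub_mul hq hr]
    refine mul_le_mul_of_nonneg_left (h _ ?_) hr.le
    have e : r ^ (-(1 / (p * α))) = x⁻¹ := Real.rpow_neg hr.le _
    have h1 : x⁻¹ ≤ w.re / 2 := by
      rw [← inv_div]
      exact inv_anti₀ (by positivity) hxw
    simp only [mem_ofPred_eq, e, re_ofReal_mul, hv, mul_one]
    exact ⟨by positivity, h1⟩
  have hre : 1 < ((x : ℂ) * w).re := by
    rw [re_ofReal_mul]
    rw [div_le_iff₀ hw] at hxw
    linarith
  have key := mittagLeffler_cpow_eq hp hp2 hα hα1 hre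
  rw [ofReal_mul_cpow hx0 hw0, ofReal_mul_cpow hx0 hw0, ← ofReal_cpow hx0.le, ← ofReal_cpow hx0.le,
    hxq, hxp] at key
  rw [key, add_sub_cancel_left, norm_mul, norm_inv, norm_mul, norm_ofNat, norm_real,
    Real.norm_of_nonneg Real.pi_pos.le]
  refine (mul_le_mul_of_nonneg_left (norm_vertInt_mlKernel_le hp hp2.le hκ hr hlow)
    (by positivity)).trans_eq ?_
  field_simp
  rfl

theorem I_cpow_neg_ofReal (γ : ℝ) :
    I ^ (-(γ : ℂ)) = exp ((-(Real.pi * γ / 2) : ℝ) * I) := by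
  rw [I_cpow]
  push_cast
  ring_nf

theorem exists_norm_mittagLeffler_algebraic {α γ : ℝ} (hα : 0 < α) (hαγ : α < γ) (hγ1 : γ ≤ 1) :
    ∃ C : ℝ, ∀ r : ℝ, 0 < r → ‖mittagLeffler α (I ^ (-(γ : ℂ)) * (r : ℂ))
      - -(I ^ (γ : ℂ) / (Real.Gamma (1 - α) : ℂ)) * ((r⁻¹ : ℝ) : ℂ)‖ ≤ C * (r ^ 2)⁻¹ := by
  have hπ := Real.pi_pos
  have hγα : 1 < γ / α := (one_lt_div hα).2 hαγ
  -- With pα < γ, the map v ↦ v^{pα} sends the closed right half-plane into |arg| ≤ pαπ/2 < γπ/2, so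
  -- it misses the ray through i^{-γ}. This needs 1 < p < γ/α, which α < γ permits.
  set p : ℝ := min ((1 + γ / α) / 2) 2 with hp
  have hp1 : 1 < p := lt_min (by linarith) one_lt_two
  have hp2 : p ≤ 2 := min_le_right _ _
  have hpγ : p * α < γ := by
    have : p < γ / α := (min_le_left _ _).trans_lt (by linarith)
    rwa [lt_div_iff₀ hα] at this
  have hq : 0 < p * α := by nlinarith
  have hζ : ∀ v : ℂ, 0 ≤ v.re → v ^ ((p * α : ℝ) : ℂ) ≠ I ^ (-(γ : ℂ)) := by
    intro v hv
    rw [I_cpow_neg_ofReal]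
    rcases eq_or_ne v 0 with rfl | hv0
    · rw [zero_cpow (ofReal_ne_zero.2 hq.ne')]
      exact (exp_ne_zero _).symm
    rw [cpow_def_of_ne_zero hv0]
    intro h
    have harg := abs_le.1 (Complex.abs_arg_le_pi_div_two_iff.2 hv)
    have him : (log v * ((p * α : ℝ) : ℂ)).im = v.arg * (p * α) := by rw [im_mul_ofReal, log_im]
    have h2 := Complex.exp_inj_of_neg_pi_lt_of_le_pi (by rw [him]; nlinarith) (by rw [him]; nlinarith)
      (by simp; nlinarith) (by simp; nlinarith) h
    have h3 := congrArg im h2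
    rw [him, im_ofReal_mul, I_im] at h3
    nlinarith
  obtain ⟨C, hC⟩ := exists_norm_mittagLeffler_add_le hp1 hp2 hα hζ
  refine ⟨C, fun r hr => ?_⟩
  convert hC r hr using 2
  rw [mul_comm (r : ℂ), mul_inv, cpow_neg, inv_inv, ofReal_inv, ofReal_inv]
  ring

theorem exists_norm_mittagLeffler_exponential {α γ : ℝ} (hα : 0 < α) (hα1 : α ≤ 1) (hγ : 0 ≤ γ)
    (hγα : γ ≤ α) :
    ∃ C R : ℝ, 0 < R ∧ ∀ r : ℝ, R ≤ r → ‖mittagLeffler α (I ^ (-(γ : ℂ)) * (r : ℂ))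
      - 1 / α * exp (((r ^ (1 / α) : ℝ) : ℂ) * exp ((-(Real.pi * (γ / α) / 2) : ℝ) * I))‖
        ≤ C * r⁻¹ := by
  have hπ := Real.pi_pos
  have h0 : 0 ≤ γ / α := by positivity
  have h1 : γ / α ≤ 1 := (div_le_one hα).2 hγα
  -- With p = 3/2 this gives w^{pα} = i^{-γ} and w^p = e^{-iπγ/(2α)}; since γ ≤ α, |arg w| ≤ π/3 and
  -- w is in the open right half-plane.
  set w : ℂ := exp ((-(Real.pi * (γ / α) / 3) : ℝ) * I) with hw
  have hwre : 0 < w.re := by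
    rw [hw, exp_ofReal_mul_I_re]
    apply Real.cos_pos_of_mem_Ioo
    constructor <;> nlinarith
  have hcpow : ∀ a : ℝ, w ^ (a : ℂ) = exp ((-(Real.pi * (γ / α) / 3) * a : ℝ) * I) := by
    intro a
    rw [hw, cpow_def_of_ne_zero (exp_ne_zero _), log_exp (by simp; nlinarith) (by simp; nlinarith)]
    push_cast
    ring_nf
  obtain ⟨C, R, hR, h⟩ := exists_norm_mittagLeffler_sub_exp_le (p := 3 / 2) (by norm_num)
    (by norm_num) hα hα1 hwre
  refine ⟨C, R, hR, fun r hr => ?_⟩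
  convert h r hr using 3
  · rw [mul_comm, hcpow, I_cpow_neg_ofReal]
    congr 5
    field_simp
  · rw [hcpow]
    congr 6
    ring

/-! ### Criteria for being tempered or not -/

/-- A bounded function is itself a tempered distribution T; composing T with `G`, a left inverse of
the Fourier transform on Schwartz functions, gives K. -/
theorem invFourierIsTempered_of_bounded {d : ℕ} {m : EuclideanSpace ℝ (Fin d) → ℂ}
    (hm : Continuous m) (C : ℝ) (hC : ∀ ξ, ‖m ξ‖ ≤ C) : InvFourierIsTempered m := by
  have hmem : MemLp m ⊤ (volume : Measure (EuclideanSpace ℝ (Fin d))) :=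
    memLp_top_of_bound hm.aestronglyMeasurable C (Eventually.of_forall hC)
  set T : 𝓢'(EuclideanSpace ℝ (Fin d), ℂ) := Lp.toTemperedDistribution hmem.toLp
  set G : 𝓢(EuclideanSpace ℝ (Fin d), ℂ) →L[ℂ] 𝓢(EuclideanSpace ℝ (Fin d), ℂ) :=
    (FourierTransform.fourierCLE ℂ 𝓢(EuclideanSpace ℝ (Fin d), ℂ)).symm.toContinuousLinearMap.comp
      (SchwartzMap.compCLMOfContinuousLinearEquiv ℂ (dilTwoPi d).symm)
  have hG : ∀ φ, G (schwartzFourier d φ) = φ := by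
    intro φ
    have h1 : SchwartzMap.compCLMOfContinuousLinearEquiv ℂ (dilTwoPi d).symm (schwartzFourier d φ)
        = FourierTransform.fourierCLE ℂ 𝓢(EuclideanSpace ℝ (Fin d), ℂ) φ := by
      ext ξ
      change (FourierTransform.fourierCLM ℂ 𝓢(EuclideanSpace ℝ (Fin d), ℂ) φ)
        ((dilTwoPi d) ((dilTwoPi d).symm ξ)) = _
      rw [ContinuousLinearEquiv.apply_symm_apply]
      rfl
    exact (congrArg (FourierTransform.fourierCLE ℂ 𝓢(EuclideanSpace ℝ (Fin d), ℂ)).symm h1).trans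
      (ContinuousLinearEquiv.symm_apply_apply _ φ)
  refine ⟨PointwiseConvergenceCLM.precomp ℂ G T, fun φ _ => ?_⟩
  change T (G (schwartzFourier d φ)) = _
  rw [hG, Lp.toTemperedDistribution_apply]
  refine integral_congr_ae ?_
  filter_upwards [hmem.coeFn_toLp] with ξ hξ
  rw [hξ, smul_eq_mul, mul_comm]

section Rescaling

variable {d : ℕ}

/-- The rescaled function `ξ ↦ g (s (ξ - a))` is again a compactly supported test function. -/
theorem exists_rescale (g : 𝓢(EuclideanSpace ℝ (Fin d), ℂ))
    (hg : HasCompactSupport (g : EuclideanSpace ℝ (Fin d) → ℂ)) {s : ℝ} (hs : s ≠ 0)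
    (a : EuclideanSpace ℝ (Fin d)) :
    ∃ φ : 𝓢(EuclideanSpace ℝ (Fin d), ℂ), HasCompactSupport (φ : EuclideanSpace ℝ (Fin d) → ℂ) ∧
      ∀ ξ, φ ξ = g (s • (ξ - a)) := by
  have h1 : HasCompactSupport fun ξ : EuclideanSpace ℝ (Fin d) => g (s • (ξ - a)) :=
    hg.comp_homeomorph ((Homeomorph.subRight a).trans (Homeomorph.smulOfNeZero s hs))
  have h2 : ContDiff ℝ (⊤ : ℕ∞) fun ξ : EuclideanSpace ℝ (Fin d) => g (s • (ξ - a)) :=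
    (g.smooth ⊤).comp (by fun_prop)
  exact ⟨h1.toSchwartzMap h2, h1, fun ξ => rfl⟩

/-- Each derivative costs a factor s, and the weight |ξ|^k costs (1 + |a|)^k, because |ξ - a| ≤ |s(ξ
- a)| for s ≥ 1. -/
theorem exists_seminorm_rescale_le (g : 𝓢(EuclideanSpace ℝ (Fin d), ℂ)) (k n : ℕ) :
    ∃ C : ℝ, 0 ≤ C ∧ ∀ (s : ℝ) (a : EuclideanSpace ℝ (Fin d)) (φ : 𝓢(EuclideanSpace ℝ (Fin d), ℂ)),
      1 ≤ s → (∀ ξ, φ ξ = g (s • (ξ - a))) →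
      SchwartzMap.seminorm ℂ k n φ ≤ C * s ^ n * (1 + ‖a‖) ^ k := by
  set C : ℝ := 2 ^ k * ((Finset.Iic (k, n)).sup fun m => SchwartzMap.seminorm ℂ m.1 m.2) g with hC
  have hC0 : 0 ≤ C := by positivity
  refine ⟨C, hC0, fun s a φ hs hφ => ?_⟩
  refine SchwartzMap.seminorm_le_bound ℂ k n φ (by positivity) fun ξ => ?_
  have e : (φ : EuclideanSpace ℝ (Fin d) → ℂ) = fun ξ => g (s • (ξ - a)) := funext hφ
  have hd : iteratedFDeriv ℝ n (φ : EuclideanSpace ℝ (Fin d) → ℂ) ξ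
      = s ^ n • iteratedFDeriv ℝ n g (s • (ξ - a)) := by
    rw [e, iteratedFDeriv_comp_sub n a ξ (f := fun ξ => g (s • ξ)),
      iteratedFDeriv_comp_const_smul _ (g.smooth n)]
  set u := s • (ξ - a) with hu
  have hξ : ‖ξ‖ ≤ (1 + ‖a‖) * (1 + ‖u‖) := by
    have h1 : ‖ξ - a‖ ≤ ‖u‖ := by
      rw [hu, norm_smul, Real.norm_of_nonneg (by linarith)]
      exact le_mul_of_one_le_left (norm_nonneg _) hs
    have h2 : ‖ξ‖ ≤ ‖ξ - a‖ + ‖a‖ := by simpa using norm_add_le (ξ - a) a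
    nlinarith [norm_nonneg a, norm_nonneg u]
  have hg := SchwartzMap.one_add_le_sup_seminorm_apply (𝕜 := ℂ) (m := (k, n)) le_rfl le_rfl g u
  rw [hd, norm_smul, norm_pow, Real.norm_of_nonneg (by linarith)]
  calc ‖ξ‖ ^ k * (s ^ n * ‖iteratedFDeriv ℝ n g u‖)
      ≤ ((1 + ‖a‖) * (1 + ‖u‖)) ^ k * (s ^ n * ‖iteratedFDeriv ℝ n g u‖) := by gcongr
    _ = ((1 + ‖u‖) ^ k * ‖iteratedFDeriv ℝ n g u‖) * s ^ n * (1 + ‖a‖) ^ k := by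
        rw [mul_pow]; ring
    _ ≤ C * s ^ n * (1 + ‖a‖) ^ k := by gcongr

/-- A tempered distribution grows at most polynomially on rescaled test functions. -/
theorem exists_norm_apply_rescale_le (T : 𝓢'(EuclideanSpace ℝ (Fin d), ℂ))
    (g : 𝓢(EuclideanSpace ℝ (Fin d), ℂ)) (M : ℕ) :
    ∃ (C : ℝ) (N : ℕ), ∀ (R : ℝ) (a : EuclideanSpace ℝ (Fin d))
      (φ : 𝓢(EuclideanSpace ℝ (Fin d), ℂ)), 1 ≤ R → ‖a‖ = R →
      (∀ ξ, φ ξ = g (R ^ M • (ξ - a))) → ‖T φ‖ ≤ C * R ^ N := by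
  have hcont : Continuous T := map_continuous T
  obtain ⟨S, D, -, hD⟩ := Seminorm.bound_of_continuous
    (schwartz_withSeminorms ℂ (EuclideanSpace ℝ (Fin d)) ℂ)
    ((normSeminorm ℂ ℂ).comp T.toLinearMap) (continuous_norm.comp hcont)
  choose B hB0 hB using exists_seminorm_rescale_le g
  -- A seminorm of index (k, n) contributes R^{Mn+k}. Summing constants and exponents over the
  -- finite family is crude but valid since R ≥ 1.
  refine ⟨D * ∑ i ∈ S, B i.1 i.2 * 2 ^ i.1, ∑ i ∈ S, (M * i.2 + i.1), fun R a φ hR ha hφ => ?_⟩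
  have h1 : ‖T φ‖ ≤ D * (S.sup (schwartzSeminormFamily ℂ (EuclideanSpace ℝ (Fin d)) ℂ)) φ := hD φ
  refine h1.trans ?_
  rw [mul_assoc]
  refine mul_le_mul_of_nonneg_left ?_ D.2
  have hs0 : ∀ i ∈ S, 0 ≤ B i.1 i.2 * (2 : ℝ) ^ i.1 := fun i _ => by
    have := hB0 i.1 i.2
    positivity
  refine Seminorm.finset_sup_apply_le (by have := Finset.sum_nonneg hs0; positivity) fun i hi => ?_
  have h2 := hB i.1 i.2 (R ^ M) a φ (one_le_pow₀ hR) hφ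
  refine h2.trans ?_
  have h3 : (1 + ‖a‖) ^ i.1 ≤ 2 ^ i.1 * R ^ i.1 := by
    rw [ha, ← mul_pow]
    gcongr
    linarith
  have h4 := hB0 i.1 i.2
  calc B i.1 i.2 * (R ^ M) ^ i.2 * (1 + ‖a‖) ^ i.1
      ≤ B i.1 i.2 * (R ^ M) ^ i.2 * (2 ^ i.1 * R ^ i.1) := by gcongr
    _ = (B i.1 i.2 * 2 ^ i.1) * R ^ (M * i.2 + i.1) := by rw [pow_add, pow_mul]; ring
    _ ≤ (∑ i ∈ S, B i.1 i.2 * 2 ^ i.1) * R ^ (∑ i ∈ S, (M * i.2 + i.1)) := by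
        refine mul_le_mul (Finset.single_le_sum hs0 hi) (pow_le_pow_right₀ hR ?_) (by positivity)
          (Finset.sum_nonneg hs0)
        exact Finset.single_le_sum (f := fun i : ℕ × ℕ => M * i.2 + i.1) (fun _ _ => Nat.zero_le _) hi

/-- A function of exponential growth whose relative oscillation is small on balls of polynomially
small radius is not a tempered distribution. -/
theorem not_invFourierIsTempered_of_exponential {m : EuclideanSpace ℝ (Fin d) → ℂ}
    (hm : Continuous m) {e : EuclideanSpace ℝ (Fin d)} (he : ‖e‖ = 1) {κ σ c : ℝ} (hκ : 0 < κ)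
    (hσ : 0 < σ) (hc : 0 < c) (M : ℕ)
    (h : ∀ᶠ R : ℝ in atTop, ∃ A : ℂ, c * Real.exp (κ * R ^ σ) ≤ ‖A‖ ∧
      ∀ ξ, ‖ξ - R • e‖ ≤ (R ^ M)⁻¹ → ‖m ξ - A‖ ≤ ‖A‖ / 2) :
    ¬ InvFourierIsTempered m := by
  rintro ⟨K, hK⟩
  set ψ : ContDiffBump (0 : EuclideanSpace ℝ (Fin d)) := ⟨1 / 2, 1, by norm_num, by norm_num⟩
  have hcs : HasCompactSupport fun ξ => (ψ ξ : ℂ) := ψ.hasCompactSupport.comp_left ofReal_zero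
  have hcd : ContDiff ℝ (⊤ : ℕ∞) fun ξ => (ψ ξ : ℂ) := ofRealCLM.contDiff.comp ψ.contDiff
  set g : 𝓢(EuclideanSpace ℝ (Fin d), ℂ) := hcs.toSchwartzMap hcd
  have hgψ : ∀ ξ, g ξ = (ψ ξ : ℂ) := fun ξ => rfl
  set J : ℝ := ∫ ξ, ψ ξ with hJ
  have hJ0 : 0 < J := ψ.integral_pos
  obtain ⟨C, N, hT⟩ := exists_norm_apply_rescale_le (temperedFourier d K) g M
  have key : ∀ᶠ R : ℝ in atTop,
      c * Real.exp (κ * R ^ σ) / 2 * ((R ^ M) ^ d)⁻¹ * J ≤ C * R ^ N := by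
    filter_upwards [h, eventually_ge_atTop 1] with R ⟨A, hA, hmA⟩ hR
    have hR0 : 0 < R := by linarith
    have hRM : 0 < R ^ M := by positivity
    obtain ⟨φ, hφc, hφ⟩ := exists_rescale g hcs hRM.ne' (R • e)
    refine le_trans ?_ (hT R (R • e) φ hR (by rw [norm_smul, he, mul_one,
      Real.norm_of_nonneg hR0.le]) hφ)
    rw [hK φ hφc]
    set χ : EuclideanSpace ℝ (Fin d) → ℝ := fun ξ => ψ (R ^ M • (ξ - R • e)) with hχ
    have hφχ : ∀ ξ, φ ξ = (χ ξ : ℂ) := fun ξ => by rw [hφ, hgψ]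
    have hχ0 : ∀ ξ, 0 ≤ χ ξ := fun ξ => ψ.nonneg
    have hφi : Integrable φ := φ.integrable
    have hχi : Integrable χ := by
      have := hφi.re
      simpa [hφχ] using this
    have hχint : ∫ ξ, χ ξ = ((R ^ M) ^ d)⁻¹ * J := by
      rw [hχ, integral_sub_right_eq_self (fun ξ => ψ (R ^ M • ξ)) (R • e),
        Measure.integral_comp_smul, finrank_euclideanSpace_fin, smul_eq_mul,
        abs_of_pos (by positivity)]
    have hmφ : Integrable fun ξ => m ξ * φ ξ :=
      (hm.mul φ.continuous).integrable_of_hasCompactSupport hφc.mul_left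
    -- The bump is supported where m is within ‖A‖/2 of A, so at least half of ‖A‖ ∫ χ survives in
    -- the pairing.
    have hdiff : ‖(∫ ξ, m ξ * φ ξ) - A * ∫ ξ, φ ξ‖ ≤ ‖A‖ / 2 * ∫ ξ, χ ξ := by
      rw [← integral_const_mul, ← integral_sub hmφ (hφi.const_mul A), ← integral_const_mul]
      refine norm_integral_le_of_norm_le (hχi.const_mul _) (Eventually.of_forall fun ξ => ?_)
      rw [← sub_mul, norm_mul, hφχ, norm_real, Real.norm_of_nonneg (hχ0 ξ)]
      by_cases hξ : ‖ξ - R • e‖ ≤ (R ^ M)⁻¹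
      · exact mul_le_mul_of_nonneg_right (hmA ξ hξ) (hχ0 ξ)
      · have : χ ξ = 0 := by
          refine ψ.zero_of_le_dist ?_
          change 1 ≤ _
          rw [dist_zero_right, norm_smul, Real.norm_of_nonneg hRM.le]
          rw [not_le, inv_lt_iff_one_lt_mul₀ hRM] at hξ
          linarith
        rw [this, mul_zero, mul_zero]
    have hφint : ∫ ξ, φ ξ = ((∫ ξ, χ ξ : ℝ) : ℂ) :=
      (integral_congr_ae (Eventually.of_forall hφχ)).trans (integral_ofReal (𝕜 := ℂ))
    have hX0 : 0 ≤ ∫ ξ, χ ξ := integral_nonneg hχ0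
    have hAn : ‖A * ∫ ξ, φ ξ‖ = ‖A‖ * ∫ ξ, χ ξ := by
      rw [norm_mul, hφint, norm_real, Real.norm_of_nonneg hX0]
    have h5 := norm_sub_norm_le (A * ∫ ξ, φ ξ) (∫ ξ, m ξ * φ ξ)
    rw [norm_sub_rev, hAn] at h5
    rw [mul_assoc, ← hχint]
    have h6 := mul_le_mul_of_nonneg_right hA hX0
    linarith
  have hlim : Tendsto (fun R : ℝ => R ^ ((M * d + N : ℕ) : ℝ) * Real.exp (-κ * R ^ σ)) atTop
      (𝓝 0) := by
    have h1 := (tendsto_rpow_mul_exp_neg_mul_atTop_nhds_zero (((M * d + N : ℕ) : ℝ) / σ) κ hκ).comp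
      (tendsto_rpow_atTop hσ)
    refine h1.congr' ?_
    filter_upwards [eventually_gt_atTop 0] with R hR
    simp only [Function.comp]
    rw [← Real.rpow_mul hR.le, mul_div_cancel₀ _ hσ.ne']
  have hlim2 := hlim.const_mul C
  rw [mul_zero] at hlim2
  have hpos : 0 < c / 2 * J := by positivity
  obtain ⟨R, hR1, hR2, hR3⟩ := (key.and ((hlim2.eventually_lt_const hpos).and
    (eventually_gt_atTop 0))).exists
  rw [Real.rpow_natCast] at hR2
  have hE : Real.exp (κ * R ^ σ) * Real.exp (-κ * R ^ σ) = 1 := by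
    rw [← Real.exp_add]; simp
  have h7 := mul_le_mul_of_nonneg_right hR1
    (by positivity : 0 ≤ R ^ (M * d) * Real.exp (-κ * R ^ σ))
  have e1 : c * Real.exp (κ * R ^ σ) / 2 * ((R ^ M) ^ d)⁻¹ * J * (R ^ (M * d) *
      Real.exp (-κ * R ^ σ)) = c / 2 * J := by
    rw [← pow_mul]
    calc _ = c / 2 * J * (Real.exp (κ * R ^ σ) * Real.exp (-κ * R ^ σ))
          * ((R ^ (M * d))⁻¹ * R ^ (M * d)) := by ring
      _ = _ := by rw [hE, inv_mul_cancel₀ (by positivity)]; ring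
  rw [e1] at h7
  have e2 : C * R ^ N * (R ^ (M * d) * Real.exp (-κ * R ^ σ))
      = C * (R ^ (M * d + N) * Real.exp (-κ * R ^ σ)) := by rw [pow_add]; ring
  linarith

end Rescaling

/-! ### The symbol m_t -/

theorem fracSymbol_eq (d : ℕ) (α β γ t : ℝ) (ξ : EuclideanSpace ℝ (Fin d)) :
    fracSymbol d α β γ t ξ
      = mittagLeffler α (I ^ (-(γ : ℂ)) * ((t ^ α * ‖ξ‖ ^ β : ℝ) : ℂ)) := by
  rw [fracSymbol, mul_assoc, ofReal_mul]

theorem continuous_fracSymbol (d : ℕ) {α β : ℝ} (γ t : ℝ) (hα : 0 < α) (hβ : 0 < β) :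
    Continuous (fracSymbol d α β γ t) := by
  have h1 : Continuous fun ξ : EuclideanSpace ℝ (Fin d) => ‖ξ‖ ^ β :=
    continuous_norm.rpow_const fun _ => Or.inr hβ.le
  exact (continuous_mittagLeffler hα).comp (continuous_const.mul (continuous_ofReal.comp h1))

theorem exists_norm_mittagLeffler_ray_le {α γ : ℝ} (hα : 0 < α) (hα1 : α ≤ 1) (hαγ : α ≤ γ)
    (hγ1 : γ ≤ 1) :
    ∃ C : ℝ, ∀ r : ℝ, 0 ≤ r → ‖mittagLeffler α (I ^ (-(γ : ℂ)) * (r : ℂ))‖ ≤ C := by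
  have hlarge : ∃ C R : ℝ, ∀ r : ℝ, R ≤ r → ‖mittagLeffler α (I ^ (-(γ : ℂ)) * (r : ℂ))‖ ≤ C := by
    rcases hαγ.lt_or_eq with h | rfl
    · obtain ⟨C, hC⟩ := exists_norm_mittagLeffler_algebraic hα h hγ1
      refine ⟨|C| + ‖I ^ (γ : ℂ) / (Real.Gamma (1 - α) : ℂ)‖, 1, fun r hr => ?_⟩
      have hr0 : 0 < r := by linarith
      refine (norm_le_norm_sub_add _ _).trans (add_le_add ((hC r hr0).trans ?_) ?_)
      · have h1 : (r ^ 2)⁻¹ ≤ 1 := inv_le_one_of_one_le₀ (one_le_pow₀ hr)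
        calc C * (r ^ 2)⁻¹ ≤ |C| * 1 := mul_le_mul (le_abs_self C) h1 (by positivity) (abs_nonneg C)
          _ = |C| := mul_one _
      · rw [norm_mul, norm_neg, norm_real, Real.norm_of_nonneg (by positivity)]
        exact mul_le_of_le_one_right (norm_nonneg _) (inv_le_one_of_one_le₀ hr)
    · obtain ⟨C, R, hR, hC⟩ := exists_norm_mittagLeffler_exponential hα hα1 hα.le le_rfl
      refine ⟨|C| * R⁻¹ + 1 / α, R, fun r hr => ?_⟩
      refine (norm_le_norm_sub_add _ _).trans (add_le_add ((hC r hr).trans ?_) ?_)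
      · exact mul_le_mul (le_abs_self C) (inv_anti₀ hR hr) (inv_nonneg.2 (hR.le.trans hr))
          (abs_nonneg C)
      · have h1 : Real.cos (-(Real.pi * 1 / 2)) = 0 := by
          rw [Real.cos_neg, mul_one, Real.cos_pi_div_two]
        rw [norm_mul, Complex.norm_exp, re_ofReal_mul, exp_ofReal_mul_I_re, div_self hα.ne', h1,
          mul_zero, Real.exp_zero, mul_one, norm_div, norm_one, norm_real,
          Real.norm_of_nonneg hα.le]
  obtain ⟨C, R, h⟩ := hlarge
  have hcont : Continuous fun r : ℝ => mittagLeffler α (I ^ (-(γ : ℂ)) * (r : ℂ)) :=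
    (continuous_mittagLeffler hα).comp (by fun_prop)
  obtain ⟨D, hD⟩ := (isCompact_Icc (a := (0 : ℝ)) (b := R)).exists_bound_of_continuousOn
    hcont.continuousOn
  refine ⟨max C D, fun r hr => ?_⟩
  rcases le_total R r with h1 | h1
  · exact (h r h1).trans (le_max_left _ _)
  · exact (hD r ⟨hr, h1⟩).trans (le_max_right _ _)

theorem invFourierIsTempered_fracSymbol (d : ℕ) {α β γ t : ℝ} (hα : 0 < α) (hα1 : α ≤ 1)
    (hβ : 0 < β) (hαγ : α ≤ γ) (hγ1 : γ ≤ 1) (ht : 0 ≤ t) :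
    InvFourierIsTempered (fracSymbol d α β γ t) := by
  obtain ⟨C, hC⟩ := exists_norm_mittagLeffler_ray_le hα hα1 hαγ hγ1
  refine invFourierIsTempered_of_bounded (continuous_fracSymbol d γ t hα hβ) C fun ξ => ?_
  rw [fracSymbol_eq]
  exact hC _ (by positivity)

/-- Write x^σ - R^σ = R^σ((x/R)^σ - 1). Differentiability at 1 bounds the second factor by a
multiple of R^{-M}/R, and R^σ ≤ R^M cancels the rest. -/
theorem exists_abs_rpow_sub_le (σ : ℝ) {M : ℕ} (hM : σ ≤ M) :
    ∃ L R₀ : ℝ, 0 ≤ L ∧ ∀ R x : ℝ, R₀ ≤ R → |x - R| ≤ (R ^ M)⁻¹ → |x ^ σ - R ^ σ| ≤ L / R := by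
  have hd : HasDerivAt (fun y : ℝ => y ^ σ) (σ * 1 ^ (σ - 1)) 1 :=
    Real.hasDerivAt_rpow_const (Or.inl one_ne_zero)
  obtain ⟨L, hL⟩ := hd.isBigO_sub.bound
  obtain ⟨δ, hδ, hL⟩ := Metric.eventually_nhds_iff.1 hL
  refine ⟨|L|, max 1 (2 / δ), abs_nonneg L, fun R x hR hx => ?_⟩
  have hR1 : 1 ≤ R := (le_max_left _ _).trans hR
  have hR0 : 0 < R := by linarith
  have hRδ : 2 / δ ≤ R := (le_max_right _ _).trans hR
  have hRM : 1 ≤ R ^ M := one_le_pow₀ hR1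
  have hx0 : 0 ≤ x := by
    have := (abs_le.1 hx).1
    have := inv_le_one_of_one_le₀ hRM
    linarith
  have h1 : |x / R - 1| ≤ (R ^ M)⁻¹ / R := by
    rw [div_sub_one hR0.ne', abs_div, abs_of_pos hR0]
    gcongr
  have h2 : |x / R - 1| < δ := by
    refine h1.trans_lt ?_
    have h3 : (R ^ M)⁻¹ ≤ 1 := inv_le_one_of_one_le₀ hRM
    rw [div_lt_iff₀ hR0]
    rw [div_le_iff₀ hδ] at hRδ
    linarith
  have h3 := hL (y := x / R) (by rwa [Real.dist_eq])
  rw [Real.one_rpow, Real.norm_eq_abs, Real.norm_eq_abs, Real.div_rpow hx0 hR0.le,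
    div_sub_one (Real.rpow_pos_of_pos hR0 σ).ne', abs_div, abs_of_pos (Real.rpow_pos_of_pos hR0 σ),
    div_le_iff₀ (Real.rpow_pos_of_pos hR0 σ)] at h3
  refine h3.trans ?_
  have h4 : R ^ σ ≤ R ^ M := by
    rw [← Real.rpow_natCast]
    exact Real.rpow_le_rpow_of_exponent_le hR1 hM
  calc L * |x / R - 1| * R ^ σ ≤ |L| * ((R ^ M)⁻¹ / R) * R ^ M := by
        gcongr
        exact le_abs_self L
    _ = |L| / R := by field_simp

theorem not_invFourierIsTempered_fracSymbol {d : ℕ} (hd : 1 ≤ d) {α β γ t : ℝ} (hα : 0 < α)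
    (hα1 : α ≤ 1) (hβ : 0 < β) (hγ : 0 ≤ γ) (hγα : γ < α) (ht : 0 < t) :
    ¬ InvFourierIsTempered (fracSymbol d α β γ t) := by
  have hπ := Real.pi_pos
  set b : ℂ := exp ((-(Real.pi * (γ / α) / 2) : ℝ) * I) with hb
  have hbn : ‖b‖ = 1 := norm_exp_ofReal_mul_I _
  have hbre : 0 < b.re := by
    have h0 : 0 ≤ γ / α := by positivity
    have h1 : γ / α < 1 := (div_lt_one hα).2 hγα
    rw [hb, exp_ofReal_mul_I_re]
    apply Real.cos_pos_of_mem_Ioo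
    constructor <;> nlinarith
  set σ : ℝ := β / α with hσ
  have hσ0 : 0 < σ := by positivity
  have hκ : 0 < t * b.re := by positivity
  obtain ⟨C, R₁, hR₁, hE⟩ := exists_norm_mittagLeffler_exponential hα hα1 hγ hγα.le
  obtain ⟨M, hM⟩ := exists_nat_ge σ
  obtain ⟨L, R₀, hL0, hL⟩ := exists_abs_rpow_sub_le σ hM
  set e : EuclideanSpace ℝ (Fin d) := EuclideanSpace.single ⟨0, hd⟩ 1
  have he : ‖e‖ = 1 := by simp [e]
  refine not_invFourierIsTempered_of_exponential (continuous_fracSymbol d γ t hα hβ) he hκ hσ0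
    (one_div_pos.2 hα) M ?_
  -- Makes the O(1/r) error of the asymptotics at most a quarter of the leading term; the threshold
  -- 8tL below does the same for the variation of the leading term over the ball.
  have ev1 : ∀ᶠ R : ℝ in atTop, 4 * α * (|C| * R₁⁻¹) ≤ Real.exp (t * b.re * R ^ σ) :=
    (Real.tendsto_exp_atTop.comp
      ((tendsto_rpow_atTop hσ0).const_mul_atTop hκ)).eventually_ge_atTop _
  have ev2 : ∀ᶠ R : ℝ in atTop, R₁ ≤ t ^ α * (R - 1) ^ β :=
    (((tendsto_rpow_atTop hβ).comp (tendsto_atTop_add_const_right atTop (-1) tendsto_id)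
      ).const_mul_atTop (Real.rpow_pos_of_pos ht α)).eventually_ge_atTop _
  filter_upwards [ev1, ev2, eventually_ge_atTop 1, eventually_ge_atTop R₀,
    eventually_ge_atTop (8 * t * L)] with R h1 h2 hR1 hR₀ h8
  have hR0 : 0 < R := by linarith
  -- The leading term at |ξ| = R. Its size is governed by Re b = cos(πγ/(2α)), positive exactly
  -- because γ < α.
  set A : ℂ := 1 / α * exp (((t * R ^ σ : ℝ) : ℂ) * b) with hA
  have hAn : ‖A‖ = 1 / α * Real.exp (t * b.re * R ^ σ) := by
    rw [hA, norm_mul, norm_div, norm_one, norm_real, Real.norm_of_nonneg hα.le, Complex.norm_exp,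
      re_ofReal_mul]
    ring_nf
  refine ⟨A, hAn.ge, fun ξ hξ => ?_⟩
  have hx : |‖ξ‖ - R| ≤ (R ^ M)⁻¹ := by
    refine le_trans ?_ hξ
    have := abs_norm_sub_norm_le ξ (R • e)
    rwa [norm_smul, he, mul_one, Real.norm_of_nonneg hR0.le] at this
  have hxR : R - 1 ≤ ‖ξ‖ := by
    have i1 := (abs_le.1 hx).1
    have i2 : (R ^ M)⁻¹ ≤ 1 := inv_le_one_of_one_le₀ (one_le_pow₀ hR1)
    linarith
  have hr : R₁ ≤ t ^ α * ‖ξ‖ ^ β := by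
    refine h2.trans ?_
    have : (0 : ℝ) ≤ R - 1 := by linarith
    gcongr
  have hpow : (t ^ α * ‖ξ‖ ^ β) ^ (1 / α) = t * ‖ξ‖ ^ σ := by
    rw [Real.mul_rpow (by positivity) (by positivity), ← Real.rpow_mul ht.le,
      ← Real.rpow_mul (norm_nonneg _), mul_one_div_cancel hα.ne', Real.rpow_one, mul_one_div]
  have hm := hE _ hr
  rw [← fracSymbol_eq, hpow] at hm
  have hm' : ‖fracSymbol d α β γ t ξ - 1 / α * exp (((t * ‖ξ‖ ^ σ : ℝ) : ℂ) * b)‖ ≤ ‖A‖ / 4 := by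
    refine hm.trans ?_
    have i1 : C * (t ^ α * ‖ξ‖ ^ β)⁻¹ ≤ |C| * R₁⁻¹ :=
      mul_le_mul (le_abs_self C) (inv_anti₀ hR₁ hr) (by positivity) (abs_nonneg C)
    refine i1.trans ?_
    rw [hAn, one_div_mul_eq_div, div_div, le_div_iff₀ (by positivity)]
    linarith
  set w : ℂ := ((t * (‖ξ‖ ^ σ - R ^ σ) : ℝ) : ℂ) * b with hw
  have hwn : ‖w‖ ≤ 1 / 8 := by
    rw [hw, norm_mul, hbn, mul_one, norm_real, Real.norm_eq_abs, abs_mul, abs_of_pos ht]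
    refine (mul_le_mul_of_nonneg_left (hL R ‖ξ‖ hR₀ hx) ht.le).trans ?_
    rw [← mul_div_assoc, div_le_iff₀ hR0]
    linarith
  have hsplit : 1 / α * exp (((t * ‖ξ‖ ^ σ : ℝ) : ℂ) * b) = A * exp w := by
    rw [hA, mul_assoc, ← Complex.exp_add, hw]
    congr 2
    push_cast
    ring
  have hsecond : ‖A * exp w - A‖ ≤ ‖A‖ / 4 := by
    have i1 : ‖exp w - 1‖ ≤ 2 * ‖w‖ := Complex.norm_exp_sub_one_le (by linarith)
    rw [← mul_sub_one, norm_mul]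
    have := mul_le_mul_of_nonneg_left (i1.trans (by linarith : 2 * ‖w‖ ≤ 1 / 4)) (norm_nonneg A)
    linarith
  rw [hsplit] at hm'
  calc ‖fracSymbol d α β γ t ξ - A‖
      ≤ ‖fracSymbol d α β γ t ξ - A * exp w‖ + ‖A * exp w - A‖ := norm_sub_le_norm_sub_add_norm_sub _ _ _
    _ ≤ ‖A‖ / 2 := by linarith

theorem mainTheorem6 (d : ℕ) (hd : 1 ≤ d) (α β γ : ℝ) (hα : 0 < α) (hα1 : α ≤ 1)
    (hβ : 0 < β) (hγ : 0 ≤ γ) (hγ1 : γ ≤ 1) :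
    (∀ t : ℝ, 0 ≤ t → Continuous (fracSymbol d α β γ t)) ∧
    (α ≤ γ →
      (∀ t : ℝ, 0 ≤ t → InvFourierIsTempered (fracSymbol d α β γ t)) ∧
      (α < γ →
        (fun ξ : EuclideanSpace ℝ (Fin d) =>
          mittagLeffler α (Complex.I ^ (-(γ : ℂ)) * ((‖ξ‖ ^ β : ℝ) : ℂ))
            - (-(Complex.I ^ (γ : ℂ) / (Real.Gamma (1 - α) : ℂ)) * ((‖ξ‖ ^ (-β) : ℝ) : ℂ)))
          =O[Bornology.cobounded (EuclideanSpace ℝ (Fin d))]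
            (fun ξ : EuclideanSpace ℝ (Fin d) => ‖ξ‖ ^ (-(2 * β)))) ∧
      (α = γ →
        (fun ξ : EuclideanSpace ℝ (Fin d) =>
          mittagLeffler α (Complex.I ^ (-(γ : ℂ)) * ((‖ξ‖ ^ β : ℝ) : ℂ))
            - (1 / (α : ℂ)) * Complex.exp (-Complex.I * ((‖ξ‖ ^ (β / α) : ℝ) : ℂ)))
          =O[Bornology.cobounded (EuclideanSpace ℝ (Fin d))]
            (fun ξ : EuclideanSpace ℝ (Fin d) => ‖ξ‖ ^ (-β)))) ∧
    (γ < α → ∀ t : ℝ, 0 < t → ¬ InvFourierIsTempered (fracSymbol d α β γ t)) := by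
  have hcob : ∀ R : ℝ, ∀ᶠ ξ in Bornology.cobounded (EuclideanSpace ℝ (Fin d)), R ≤ ‖ξ‖ ^ β :=
    fun R => ((tendsto_rpow_atTop hβ).comp tendsto_norm_cobounded_atTop).eventually_ge_atTop R
  refine ⟨fun t _ => continuous_fracSymbol d γ t hα hβ, fun hαγ => ⟨fun t ht =>
    invFourierIsTempered_fracSymbol d hα hα1 hβ hαγ hγ1 ht, fun h => ?_, fun h => ?_⟩,
    fun h t ht => not_invFourierIsTempered_fracSymbol hd hα hα1 hβ hγ h ht⟩
  · obtain ⟨C, hC⟩ := exists_norm_mittagLeffler_algebraic hα h hγ1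
    refine Asymptotics.IsBigO.of_bound C ?_
    filter_upwards [hcob 1] with ξ hξ
    have h1 := hC (‖ξ‖ ^ β) (by linarith)
    have h2 : ‖ξ‖ ^ (-(2 * β)) = ((‖ξ‖ ^ β) ^ 2)⁻¹ := by
      rw [Real.rpow_neg (norm_nonneg _), mul_comm, Real.rpow_mul (norm_nonneg _), Real.rpow_two]
    rw [Real.norm_of_nonneg (Real.rpow_nonneg (norm_nonneg _) _), h2,
      Real.rpow_neg (norm_nonneg _)]
    exact h1
  · obtain ⟨C, R, -, hC⟩ := exists_norm_mittagLeffler_exponential hα hα1 hγ h.ge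
    refine Asymptotics.IsBigO.of_bound C ?_
    filter_upwards [hcob R] with ξ hξ
    have h1 := hC (‖ξ‖ ^ β) hξ
    have h2 : exp ((-(Real.pi * (γ / α) / 2) : ℝ) * I) = -I := by
      rw [h, div_self (h ▸ hα.ne'), mul_one, ofReal_neg, neg_mul, Complex.exp_neg]
      push_cast
      rw [exp_pi_div_two_mul_I, inv_I]
    rw [h2, ← Real.rpow_mul (norm_nonneg _), mul_one_div, mul_comm _ (-I)] at h1
    rw [Real.norm_of_nonneg (Real.rpow_nonneg (norm_nonneg _) _), Real.rpow_neg (norm_nonneg _)]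
    exact h1
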